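/- **Theorem (strong duality).** Let $\mathcal X$ be a compact Polish space, $\mathcal Y=\{\mathbf y^k\}_{k=1}^{N_{\mathcal Y}}$ a finite set (with the discrete topology) and $\mathcal Z=\mathcal X\times\mathcal Y$. Let $\mathbb P_{\mathcal X}$ be a Borel probability measure on $\mathcal X$, let $\hat{\mathbb P}_l=\frac1{N_l}\sum_{i=1}^{N_l}\delta_{\mathbf z_\ell^i}$ be the empirical measure of points $\mathbf z_\ell^1,\dots,\mathbf z_\ell^{N_l}\in\mathcal Z$, $N_l\ge1$, and let $[\underline{\mathbf p}^k,\overline{\mathbf p}^k]\subseteq[0,1]$, $k=1,\dots,N_{\mathcal Y}$, be intervals. Let $c:\mathcal Z\times\mathcal Z\to[0,\infty)$ be upper semicontinuous with $c(\mathbf z,\mathbf z')=0\Leftrightarrow\mathbf z=\mathbf z'$, and let $\varepsilon\in\mathbb R$. Let $\Theta\subseteq\mathbb R^q$, let $h_\theta$ ($\theta\in\Theta$) map $\mathcal X$ to the probability measures on $\mathcal Y$, and let $\ell$ be a real function of a probability measure on $\mathcal Y$ and a label, such that for each $\theta\in\Theta$ the function $\ell_\theta(\mathbf x,\mathbf y)=\ell(h_\theta(\mathbf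 x),\mathbf y)$ is upper semicontinuous on $\mathcal Z$. (Then $\ell_\theta$ is bounded above, and expectations of $\ell_\theta$ and of the finite maximum below are taken in $[-\infty,\infty)$.) For probability measures $\mu,\nu$ on $\mathcal Z$ let $\mathcal W_c(\mu,\nu)=\inf_\pi\int c\,d\pi$ over all couplings $\pi$ of $\mu$ and $\nu$. Let the decision set $\mathcal P$ be the set of all probability measures $\mu$ on $\mathcal Z$ with $\mathcal X$-marginal $\mathbb P_{\mathcal X}$, with $\mu(\mathcal X\times\{\mathbf y^k\})\in[\underline{\mathbf p}^k,\overline{\mathbf p}^k]$ for all $k$, and with $\mathcal W_c(\mu,\hat{\mathbb P}_l)\le\varepsilon$. Put $f(\theta)=\sup_{\mu\in\mathcal P}\mathbf E^\mu\,\ell_\theta(X,Y)$ and $$g(\theta)=\inf\Bigl\{G_\theta(\alpha,\beta,\overline\lambda,\underline\lambda):\ \alpha\ge0,\ \beta\in\mathbb R^{N_l},\ \overline\lambda,\underline\lambda\in\mathbb R_+^{N_{\mathcal Y}}\Bigr\},$$ $$G_\theta=\alpha\varepsilon+\frac1{N_l}\sum_{i=1}^{N_l}\beta^i+\sum_{k=1}^{N_{\mathcal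 Y}}\bigl(\overline\lambda^k\overline{\mathbf p}^k-\underline\lambda^k\underline{\mathbf p}^k\bigr)+\mathbf E^{\mathbb P_{\mathcal X}}\Bigl[\max_{k,i}\ \ell_\theta(X,\mathbf y^k)-\bigl(\alpha\,c((X,\mathbf y^k),\mathbf z_\ell^i)+\beta^i\bigr)-(\overline\lambda^k-\underline\lambda^k)\Bigr].$$ 1. If $\mathcal P\ne\emptyset$, then $f(\theta)=g(\theta)$ for all $\theta\in\Theta$. 2. Suppose that $\mathcal P$ has nonempty relative interior in the sense of strict feasibility: there is $\mu\in\mathcal P$ with $\mathcal W_c(\mu,\hat{\mathbb P}_l)<\varepsilon$ and $\mu(\mathcal X\times\{\mathbf y^k\})\in(\underline{\mathbf p}^k,\overline{\mathbf p}^k)$ for every $k$ with $\underline{\mathbf p}^k<\overline{\mathbf p}^k$. Let $\theta\in\Theta$, and suppose that $\overline{\mathbf p}^k>0$ for all $k$ or that $\ell_\theta$ is bounded below. Then there is $(\alpha_*,\beta_*,\overline\lambda_*,\underline\lambda_*)\in\mathbb R_+\times\mathbb R^{N_l}\times\mathbb R_+^{N_{\mathcal Y}}\times\mathbb R_+^{N_{\mathcal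 Y}}$ attaining the infimum that defines $g(\theta)$. -/

import Mathlib

open MeasureTheory
open scoped ENNReal

noncomputable section

namespace DRL

/-- Expectation of a real function with values in the extended reals: the integral of the positive
part minus the integral of the negative part. It equals the usual integral for an integrable
function, and it is `⊥` for a function that is bounded above and not integrable (the case
`∞ - ∞` does not occur for functions that are bounded above and finite measures). -/
def expect {S : Type*} [MeasurableSpace S] (μ : Measure S) (φ : S → ℝ) : EReal :=
  ((∫⁻ s, ENNReal.ofReal (φ s) ∂μ : ℝ≥0∞) : EReal)
    - ((∫⁻ s, ENNReal.ofReal (-φ s) ∂μ : ℝ≥0∞) : EReal)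

/-- The couplings (transport plans) of two measures. -/
def couplings {Z : Type*} [MeasurableSpace Z] (μ ν : Measure Z) : Set (Measure (Z × Z)) :=
  {π | π.map Prod.fst = μ ∧ π.map Prod.snd = ν}

/-- The Wasserstein distance (optimal transport cost) for a nonnegative cost `c`. -/
def wasserstein {Z : Type*} [MeasurableSpace Z] (c : Z × Z → ℝ) (μ ν : Measure Z) : ℝ≥0∞ :=
  ⨅ π ∈ couplings μ ν, ∫⁻ p, ENNReal.ofReal (c p) ∂π

/-- The empirical measure of a sample of size `N`. -/
def empirical {Z : Type*} [MeasurableSpace Z] {N : ℕ} (z : Fin N → Z) : Measure Z :=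
  (N : ℝ≥0∞)⁻¹ • ∑ i, Measure.dirac (z i)

section Problem

variable {X Y : Type*} [MeasurableSpace X] [MeasurableSpace Y]

/-- The probability of the label `y` under a measure on `X × Y`. -/
def labelProb (μ : Measure (X × Y)) (y : Y) : ℝ :=
  μ.real (Set.univ ×ˢ {y})

/-- The measures on `X × Y` with `X`-marginal `PX` and with label probabilities in the
intervals `[pL y, pU y]`. -/
def marginalSet (PX : Measure X) (pL pU : Y → ℝ) : Set (Measure (X × Y)) :=
  {μ | μ.map Prod.fst = PX ∧ ∀ y, labelProb μ y ∈ Set.Icc (pL y) (pU y)}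

/-- The probability measures at Wasserstein distance at most `ε` from `ν`. -/
def wassersteinBall (c : (X × Y) × (X × Y) → ℝ) (ε : ℝ) (ν : Measure (X × Y)) :
    Set (Measure (X × Y)) :=
  {μ | IsProbabilityMeasure μ ∧ ((wasserstein c μ ν : ℝ≥0∞) : EReal) ≤ (ε : EReal)}

/-- The decision set of the adversary. -/
def decisionSet (PX : Measure X) (pL pU : Y → ℝ) (c : (X × Y) × (X × Y) → ℝ) (ε : ℝ) {N : ℕ}
    (z : Fin N → X × Y) : Set (Measure (X × Y)) :=
  marginalSet PX pL pU ∩ wassersteinBall c ε (empirical z)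

/-- The relative interior of the decision set, in the sense of strict feasibility: the members
of the decision set for which the transport constraint is strict and every label constraint is
strict, except those with `pL y = pU y`, which are equality constraints. -/
def relintDecisionSet (PX : Measure X) (pL pU : Y → ℝ) (c : (X × Y) × (X × Y) → ℝ) (ε : ℝ) {N : ℕ}
    (z : Fin N → X × Y) : Set (Measure (X × Y)) :=
  {μ ∈ decisionSet PX pL pU c ε z |
    ((wasserstein c μ (empirical z) : ℝ≥0∞) : EReal) < (ε : EReal) ∧
      ∀ y, pL y < pU y → labelProb μ y ∈ Set.Ioo (pL y) (pU y)}

/-- The worst-case expected value of the loss `L (x, y)` over the decision set. -/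
def worstCase (PX : Measure X) (pL pU : Y → ℝ) (c : (X × Y) × (X × Y) → ℝ) (ε : ℝ) {N : ℕ}
    (z : Fin N → X × Y) (L : X × Y → ℝ) : EReal :=
  ⨆ μ ∈ decisionSet PX pL pU c ε z, expect μ L

/-- The dual variables `(α, β, lamU, lamL)`. -/
structure DualVar (Y : Type*) (N : ℕ) where
  α : ℝ
  β : Fin N → ℝ
  lamU : Y → ℝ
  lamL : Y → ℝ

/-- The sign constraints of the dual problem. -/
def DualVar.Feasible {N : ℕ} (d : DualVar Y N) : Prop :=
  0 ≤ d.α ∧ (∀ y, 0 ≤ d.lamU y) ∧ ∀ y, 0 ≤ d.lamL y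

/-- The finite maximum over labels and sample points inside the dual objective (a supremum over
a finite index set, nonempty as soon as there is a sample point). -/
def dualMax (c : (X × Y) × (X × Y) → ℝ) {N : ℕ} (z : Fin N → X × Y) (L : X × Y → ℝ)
    (d : DualVar Y N) (x : X) : ℝ :=
  ⨆ p : Y × Fin N,
    L (x, p.1) - (d.α * c ((x, p.1), z p.2) + d.β p.2) - (d.lamU p.1 - d.lamL p.1)

/-- The dual objective. -/
def dualObjective [Fintype Y] (PX : Measure X) (pL pU : Y → ℝ) (c : (X × Y) × (X × Y) → ℝ)
    (ε : ℝ) {N : ℕ} (z : Fin N → X × Y) (L : X × Y → ℝ) (d : DualVar Y N) : EReal :=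
  ((d.α * ε + (1 / (N : ℝ)) * ∑ i, d.β i + ∑ y, (d.lamU y * pU y - d.lamL y * pL y) : ℝ) : EReal)
    + expect PX (dualMax c z L d)

/-- The value of the dual problem. -/
def dualValue [Fintype Y] (PX : Measure X) (pL pU : Y → ℝ) (c : (X × Y) × (X × Y) → ℝ)
    (ε : ℝ) {N : ℕ} (z : Fin N → X × Y) (L : X × Y → ℝ) : EReal :=
  ⨅ (d : DualVar Y N) (_ : d.Feasible), dualObjective PX pL pU c ε z L d

end Problem

end DRL

end

/-!
The couplings of a measure on `X × Y` with the empirical measure of `N` points are encoded by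
measures on `X × (Y × Fin N)`, called plans, that also record the index of the sample point
(`exists_plan_of_coupling`, `map_pairWithSample_mem_couplings`). Only the first coordinate of a plan
is infinite and its law is fixed, so all plans are dominated by the product of that law with the
counting measure. Their densities are weakly compact in `L²`, and hence the integrals of all bounded
measurable functions against plans form a compact set (`isCompact_integrals_of_marginal`). This
replaces the usual weak compactness of couplings, which would need a continuous cost and loss: a
bounded measurable cost is enough, and semicontinuity enters only through boundedness from above
and measurability.

Weak duality integrates the pointwise bound of the penalized loss by the dual maximum
(`integral_sub_penalty_le`). For the converse with a bounded loss, the attainable values of the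
constraints and of the expected loss form a compact convex set in a finite-dimensional space, and
Hahn-Banach separates it from the values that would beat the bound
(`exists_dual_le_of_forall_lt`). Since the set is compact, no constraint qualification is needed.
The supremum over plans of the penalized loss is the expected dual maximum, by a measurable choice
of the best label and sample point. A general loss is truncated from below, and the transport budget
is relaxed slightly because the infimum over couplings need not be known to be attained; one more
use of compactness and monotone convergence remove the truncation and the relaxation
(`dualValue_le_worstCase`).

For attainment, either the dual objective is identically `⊥`, or it is finite and continuous. In the
second case it is coercive up to two invariances, the shift of all `β i` and, if all label
constraints are equalities, the shift of all label multipliers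
(`exists_normalized_multipliers`). The strictly feasible plan controls `α` and the multipliers of
the inequality constraints, and the plans concentrated on one label and one sample point control the
rest (`multiplier_bounds`). The loss may fail to be integrable under these plans; this is repaired
by using the best label on a set of small probability where the loss is very negative, at the price
of an error that is a small multiple of the size of the multipliers
(`exists_neg_penalty_le_integral_dualMax`). Labels that must have probability `0` are not controlled
by any plan; for a loss that is bounded below, a large multiplier makes them irrelevant.
-/

namespace DRL


/-! ### Setwise compactness of dominated measures -/

section Compactness

variable {T : Type*} [MeasurableSpace T]

/-- The bounded measurable real functions, used as test functions for measures. -/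
structure TestFun (T : Type*) [MeasurableSpace T] where
  toFun : T → ℝ
  measurable : Measurable toFun
  bounded : ∃ C, ∀ t, |toFun t| ≤ C

lemma TestFun.integrable (a : TestFun T) (ρ : Measure T) [IsFiniteMeasure ρ] :
    Integrable a.toFun ρ := by
  obtain ⟨C, hC⟩ := a.bounded
  exact Integrable.of_bound a.measurable.aestronglyMeasurable C (Filter.Eventually.of_forall hC)

lemma TestFun.memLp_two (a : TestFun T) (ν : Measure T) [IsFiniteMeasure ν] :
    MemLp a.toFun 2 ν := by
  obtain ⟨C, hC⟩ := a.bounded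
  exact MemLp.of_bound a.measurable.aestronglyMeasurable C (Filter.Eventually.of_forall hC)

/-- The indicator function of a measurable set as a test function. -/
noncomputable def TestFun.indicator {E : Set T} (hE : MeasurableSet E) : TestFun T :=
  ⟨E.indicator fun _ => 1, measurable_const.indicator hE, 1, fun t => by
    by_cases ht : t ∈ E <;> simp [ht]⟩

/-- The measures dominated by a finite measure form a compact set for setwise convergence, here
expressed through their integrals against all test functions. By Radon-Nikodym these measures
are the densities with values in `[0, 1]`, which are weakly compact in `L²` by Banach-Alaoglu. -/
lemma isCompact_integrals_of_le (ν : Measure T) [IsFiniteMeasure ν] :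
    IsCompact {v : TestFun T → ℝ | ∃ ρ : Measure T, ρ ≤ ν ∧ ∀ a, v a = ∫ t, a.toFun t ∂ρ} := by
  let W := Lp ℝ 2 ν
  let e : TestFun T → W := fun a => (a.memLp_two ν).toLp a.toFun
  obtain ⟨r, hr⟩ : ∃ r : ℝ, ∀ w : W, (∀ᵐ t ∂ν, ‖w t‖ ≤ 1) → ‖w‖ ≤ r :=
    ⟨_, fun w hw => Lp.norm_le_of_ae_bound zero_le_one hw⟩
  have hin : ∀ (w : W) (a : TestFun T), inner ℝ w (e a) = ∫ t, w t * a.toFun t ∂ν := by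
    intro w a
    rw [L2.inner_def]
    refine integral_congr_ae ?_
    filter_upwards [(a.memLp_two ν).coeFn_toLp] with t ht
    simp only [e, ht, RCLike.inner_apply, conj_trivial]
    ring
  let D : Set (WeakDual ℝ W) :=
    (WeakDual.toStrongDual ⁻¹' Metric.closedBall 0 r) ∩
      ⋂ (E : {E : Set T // MeasurableSet E}),
        {φ | 0 ≤ φ (e (TestFun.indicator E.2)) ∧ φ (e (TestFun.indicator E.2)) ≤ ν.real E.1}
  have hD : IsCompact D := by
    refine (WeakDual.isCompact_closedBall (𝕜 := ℝ) (0 : StrongDual ℝ W) r).inter_right ?_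
    refine isClosed_iInter fun E => ?_
    exact (isClosed_le continuous_const (WeakDual.eval_continuous _)).inter
      (isClosed_le (WeakDual.eval_continuous _) continuous_const)
  have hcont : Continuous fun (φ : WeakDual ℝ W) (a : TestFun T) => φ (e a) :=
    continuous_pi fun a => WeakDual.eval_continuous _
  convert hD.image hcont using 1
  ext v
  simp only [Set.mem_ofPred_eq, Set.mem_image]
  constructor
  · rintro ⟨ρ, hρ, hv⟩
    have : IsFiniteMeasure ρ := isFiniteMeasure_of_le ν hρ
    have hac : ρ ≪ ν := Measure.absolutelyContinuous_of_le hρ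
    have hle : ∀ᵐ t ∂ν, ‖(ρ.rnDeriv ν t).toReal‖ ≤ 1 := by
      filter_upwards [Measure.rnDeriv_le_one_of_le hρ] with t ht
      rw [Real.norm_of_nonneg ENNReal.toReal_nonneg]
      exact ENNReal.toReal_le_of_le_ofReal zero_le_one (by simpa using ht)
    have hmem : MemLp (fun t => (ρ.rnDeriv ν t).toReal) 2 ν :=
      MemLp.of_bound (ρ.measurable_rnDeriv ν).ennreal_toReal.aestronglyMeasurable 1 hle
    let w : W := hmem.toLp _
    have hw : ∀ a, inner ℝ w (e a) = ∫ t, a.toFun t ∂ρ := by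
      intro a
      rw [hin, ← integral_rnDeriv_smul hac]
      refine integral_congr_ae ?_
      filter_upwards [hmem.coeFn_toLp] with t ht
      simp only [w, ht, smul_eq_mul]
    refine ⟨StrongDual.toWeakDual (InnerProductSpace.toDual ℝ W w), ⟨?_, ?_⟩, ?_⟩
    · have : ‖w‖ ≤ r := hr w (by
        filter_upwards [hmem.coeFn_toLp, hle] with t h1 h2
        rw [h1]; exact h2)
      simpa [Metric.mem_closedBall] using this
    · refine Set.mem_iInter.2 fun E => ?_
      have h1 : (InnerProductSpace.toDual ℝ W w) (e (TestFun.indicator E.2)) = ρ.real E.1 := by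
        rw [InnerProductSpace.toDual_apply_apply, hw]
        simp [TestFun.indicator, integral_indicator E.2]
      constructor
      · exact (measureReal_nonneg).trans_eq h1.symm
      · refine h1.trans_le ?_
        exact ENNReal.toReal_mono (measure_ne_top _ _) (hρ E.1)
    · funext a
      rw [hv a, ← hw a]
      rfl
  · rintro ⟨φ, ⟨-, hφ⟩, rfl⟩
    let w : W := (InnerProductSpace.toDual ℝ W).symm (WeakDual.toStrongDual φ)
    have hw : ∀ f, φ f = inner ℝ w f := fun f => by
      simp only [w, InnerProductSpace.toDual_symm_apply]; rfl
    have hwi : Integrable w ν := (Lp.memLp w).integrable (by norm_num)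
    have hset : ∀ E, MeasurableSet E →
        0 ≤ ∫ t in E, w t ∂ν ∧ ∫ t in E, w t ∂ν ≤ ν.real E := by
      intro E hE
      have h1 := Set.mem_iInter.1 hφ ⟨E, hE⟩
      simp only [Set.mem_ofPred_eq, hw, hin] at h1
      have h2 : ∫ t, w t * (TestFun.indicator hE).toFun t ∂ν = ∫ t in E, w t ∂ν := by
        rw [← integral_indicator hE]
        refine integral_congr_ae (Filter.Eventually.of_forall fun t => ?_)
        by_cases ht : t ∈ E <;> simp [TestFun.indicator, ht]
      rwa [h2] at h1
    have hw0 : 0 ≤ᵐ[ν] w :=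
      ae_nonneg_of_forall_setIntegral_nonneg hwi fun E hE _ => (hset E hE).1
    refine ⟨ν.withDensity fun t => ENNReal.ofReal (w t), ?_, ?_⟩
    · refine Measure.le_iff.2 fun E hE => ?_
      rw [withDensity_apply _ hE, ← ofReal_integral_eq_lintegral_ofReal hwi.integrableOn
        (ae_restrict_of_ae hw0)]
      refine (ENNReal.ofReal_le_ofReal (hset E hE).2).trans ?_
      rw [ofReal_measureReal]
    · intro a
      change φ (e a) = _
      rw [hw, hin, integral_withDensity_eq_integral_toReal_smul₀
        (Lp.aestronglyMeasurable w).aemeasurable.ennreal_ofReal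
        (Filter.Eventually.of_forall fun t => ENNReal.ofReal_lt_top)]
      refine integral_congr_ae ?_
      filter_upwards [hw0] with t ht
      rw [ENNReal.toReal_ofReal ht, smul_eq_mul]

end Compactness

/-! ### Measures with a prescribed marginal and finitely many labels -/

section Plans

variable {X J : Type*} [MeasurableSpace X] [MeasurableSpace J]

/-- Domination by a single finite measure, which makes the compactness of dominated measures
applicable. -/
lemma measure_le_prod_count [Finite J] [MeasurableSingletonClass J]
    {ρ : Measure (X × J)} {PX : Measure X} [SFinite PX] (h : ρ.map Prod.fst = PX) :
    ρ ≤ PX.prod Measure.count := by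
  classical
  have := Fintype.ofFinite J
  refine Measure.le_iff.2 fun E hE => ?_
  have hsec : ∀ j : J, MeasurableSet ((fun x => (x, j)) ⁻¹' E) := fun j =>
    (measurable_id.prodMk measurable_const) hE
  calc ρ E ≤ ρ (⋃ j : J, Prod.fst ⁻¹' ((fun x => (x, j)) ⁻¹' E)) := by
        refine measure_mono fun p hp => ?_
        exact Set.mem_iUnion.2 ⟨p.2, hp⟩
    _ ≤ ∑ j, ρ (Prod.fst ⁻¹' ((fun x => (x, j)) ⁻¹' E)) := measure_iUnion_fintype_le _ _
    _ = ∑ j, PX ((fun x => (x, j)) ⁻¹' E) := by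
        refine Finset.sum_congr rfl fun j _ => ?_
        rw [← h, Measure.map_apply measurable_fst (hsec j)]
    _ = (PX.prod Measure.count) E := by
        rw [Measure.prod_apply_symm hE, lintegral_count, tsum_fintype]

/-- The measures with a given first marginal and finitely many second coordinates form a compact
set for setwise convergence. -/
lemma isCompact_integrals_of_marginal [Finite J] [MeasurableSingletonClass J]
    (PX : Measure X) [IsFiniteMeasure PX] :
    IsCompact {v : TestFun (X × J) → ℝ |
      ∃ ρ : Measure (X × J), ρ.map Prod.fst = PX ∧ ∀ a, v a = ∫ t, a.toFun t ∂ρ} := by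
  have hcl : IsClosed (⋂ B : {B : Set X // MeasurableSet B},
      {v : TestFun (X × J) → ℝ | v (TestFun.indicator (measurable_fst B.2)) = PX.real B.1}) :=
    isClosed_iInter fun B => isClosed_eq (continuous_apply _) continuous_const
  have hfin : IsFiniteMeasure (PX.prod (Measure.count : Measure J)) := inferInstance
  convert (isCompact_integrals_of_le (PX.prod (Measure.count : Measure J))).inter_right hcl using 1
  have hind : ∀ (ρ : Measure (X × J)) (B : {B : Set X // MeasurableSet B}),
      ∫ t, (TestFun.indicator (measurable_fst (β := J) B.2)).toFun t ∂ρ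
        = ρ.real (Prod.fst ⁻¹' B.1) := fun ρ B => by
    simp [TestFun.indicator, integral_indicator (measurable_fst B.2)]
  ext v
  constructor
  · rintro ⟨ρ, hρ, hv⟩
    refine ⟨⟨ρ, measure_le_prod_count hρ, hv⟩, Set.mem_iInter.2 fun B => ?_⟩
    simp only [Set.mem_ofPred_eq, hv, hind]
    rw [← hρ, map_measureReal_apply measurable_fst B.2]
  · rintro ⟨⟨ρ, hρ, hv⟩, hB⟩
    have : IsFiniteMeasure ρ := isFiniteMeasure_of_le _ hρ
    refine ⟨ρ, Measure.ext fun B hB' => ?_, hv⟩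
    have h1 := Set.mem_iInter.1 hB ⟨B, hB'⟩
    have h1 := (hv _).symm.trans h1
    rw [hind ρ ⟨B, hB'⟩] at h1
    rw [Measure.map_apply measurable_fst hB']
    exact (measureReal_eq_measureReal_iff).1 h1

/-- A measurable selection of a maximizer over a finite set. -/
lemma exists_measurable_argmax [Finite J] [Nonempty J] [MeasurableSingletonClass J]
    (h : X × J → ℝ) (hh : Measurable h) :
    ∃ s : X → J, Measurable s ∧ ∀ x j, h (x, j) ≤ h (x, s x) := by
  classical
  have := Fintype.ofFinite J
  suffices H : ∀ F : Finset J, ∃ s : X → J, Measurable s ∧ ∀ x, ∀ j ∈ F, h (x, j) ≤ h (x, s x) by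
    obtain ⟨s, hs, hmax⟩ := H Finset.univ
    exact ⟨s, hs, fun x j => hmax x j (Finset.mem_univ j)⟩
  intro F
  induction F using Finset.induction_on with
  | empty => exact ⟨fun _ => Classical.arbitrary J, measurable_const, by simp⟩
  | insert j F _ ih =>
    obtain ⟨s, hs, hmax⟩ := ih
    have hset : MeasurableSet {x | h (x, s x) < h (x, j)} :=
      measurableSet_lt (hh.comp (measurable_id.prodMk hs))
        (hh.comp (measurable_id.prodMk measurable_const))
    refine ⟨fun x => if h (x, s x) < h (x, j) then j else s x,
      Measurable.ite hset measurable_const hs, fun x i hi => ?_⟩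
    by_cases hx : h (x, s x) < h (x, j)
    · simp only [hx, if_true]
      rcases Finset.mem_insert.1 hi with rfl | hi
      · exact le_rfl
      · exact (hmax x i hi).trans hx.le
    · simp only [hx, if_false]
      rcases Finset.mem_insert.1 hi with rfl | hi
      · exact not_lt.1 hx
      · exact hmax x i hi

end Plans

/-! ### Expectations with values in the extended reals -/

section Expectation

variable {S : Type*} [MeasurableSpace S]

lemma expect_of_integrable {μ : Measure S} {φ : S → ℝ} (h : Integrable φ μ) :
    expect μ φ = ((∫ s, φ s ∂μ : ℝ) : EReal) := by
  rw [expect, integral_eq_lintegral_pos_part_sub_lintegral_neg_part h, EReal.coe_sub]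
  have h1 : (∫⁻ s, ENNReal.ofReal (φ s) ∂μ) ≠ ∞ := h.lintegral_lt_top.ne
  have h2 : (∫⁻ s, ENNReal.ofReal (-φ s) ∂μ) ≠ ∞ := h.neg.lintegral_lt_top.ne
  rw [EReal.coe_ennreal_toReal h1, EReal.coe_ennreal_toReal h2]

lemma expect_eq_bot {μ : Measure S} [IsFiniteMeasure μ] {φ : S → ℝ} {C : ℝ} (hφ : Measurable φ)
    (hC : ∀ s, φ s ≤ C) (h : ¬ Integrable φ μ) : expect μ φ = ⊥ := by
  have h1 : (∫⁻ s, ENNReal.ofReal (φ s) ∂μ) < ∞ := by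
    refine (lintegral_mono fun s => ENNReal.ofReal_le_ofReal (hC s)).trans_lt ?_
    rw [lintegral_const]
    exact ENNReal.mul_lt_top ENNReal.ofReal_lt_top (measure_lt_top _ _)
  have h2 : (∫⁻ s, ENNReal.ofReal (-φ s) ∂μ) = ∞ := by
    by_contra hne
    apply h
    refine ⟨hφ.aestronglyMeasurable, ?_⟩
    rw [hasFiniteIntegral_iff_norm]
    calc ∫⁻ s, ENNReal.ofReal ‖φ s‖ ∂μ
        ≤ ∫⁻ s, (ENNReal.ofReal (φ s) + ENNReal.ofReal (-φ s)) ∂μ := by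
          refine lintegral_mono fun s => ?_
          rcases le_total 0 (φ s) with hs | hs
          · rw [Real.norm_of_nonneg hs]; exact le_self_add
          · rw [Real.norm_of_nonpos hs]; exact le_add_self
      _ = _ := lintegral_add_left hφ.ennreal_ofReal _
      _ < ∞ := ENNReal.add_lt_top.2 ⟨h1, lt_top_iff_ne_top.2 hne⟩
  rw [expect, h2, EReal.coe_ennreal_top, EReal.sub_top]

lemma expect_mono {μ : Measure S} {φ ψ : S → ℝ} (h : ∀ s, φ s ≤ ψ s) :
    expect μ φ ≤ expect μ ψ := by
  refine EReal.sub_le_sub ?_ ?_ <;> rw [EReal.coe_ennreal_le_coe_ennreal_iff] <;>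
    refine lintegral_mono fun s => ENNReal.ofReal_le_ofReal ?_
  · exact h s
  · exact neg_le_neg (h s)

/-- If the truncations `max φ (-n)` of a function that is bounded above have integrals at least
`t`, so does the function itself: monotone convergence. -/
lemma integrable_of_le_integral_truncation {μ : Measure S} [IsProbabilityMeasure μ] {φ : S → ℝ}
    {C t : ℝ} (hφ : Measurable φ) (hC : ∀ s, φ s ≤ C)
    (ht : ∀ n : ℕ, t ≤ ∫ s, max (φ s) (-n) ∂μ) : Integrable φ μ ∧ t ≤ ∫ s, φ s ∂μ := by
  have hint : ∀ n : ℕ, Integrable (fun s => max (φ s) (-n : ℝ)) μ := fun n => by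
    refine Integrable.of_bound (hφ.max measurable_const).aestronglyMeasurable (|C| + n)
      (Filter.Eventually.of_forall fun s => ?_)
    rw [Real.norm_eq_abs, abs_le]
    have := hC s
    have := le_abs_self C
    have := abs_nonneg C
    have hn : (0 : ℝ) ≤ n := Nat.cast_nonneg n
    exact ⟨by linarith [le_max_right (φ s) (-n : ℝ)], max_le (by linarith) (by linarith)⟩
  have hCt : ∀ n : ℕ, -n ≤ C → ∫⁻ s, ENNReal.ofReal (C - max (φ s) (-n)) ∂μ
      ≤ ENNReal.ofReal (C - t) := fun n hn => by
    rw [← ofReal_integral_eq_lintegral_ofReal (f := fun s => C - max (φ s) (-n : ℝ))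
      ((integrable_const C).sub (hint n))
      (Filter.Eventually.of_forall fun s => sub_nonneg.2 (max_le (hC s) hn))]
    refine ENNReal.ofReal_le_ofReal ?_
    rw [integral_sub (integrable_const C) (hint n)]
    simp only [integral_const, probReal_univ, smul_eq_mul, one_mul]
    linarith [ht n]
  have hsup : ∫⁻ s, ENNReal.ofReal (C - φ s) ∂μ ≤ ENNReal.ofReal (C - t) := by
    have hlim : ∀ s, Filter.Tendsto (fun n : ℕ => ENNReal.ofReal (C - max (φ s) (-n)))
        Filter.atTop (nhds (ENNReal.ofReal (C - φ s))) := fun s => by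
      obtain ⟨m, hm⟩ := exists_nat_ge (-φ s)
      refine tendsto_const_nhds.congr' ?_
      filter_upwards [Filter.eventually_ge_atTop m] with n hn
      have : (m : ℝ) ≤ n := by exact_mod_cast hn
      rw [max_eq_left (by linarith)]
    have hmeas : ∀ n : ℕ, AEMeasurable (fun s => ENNReal.ofReal (C - max (φ s) (-n))) μ :=
      fun n => (measurable_const.sub (hφ.max measurable_const)).ennreal_ofReal.aemeasurable
    refine le_of_tendsto (lintegral_tendsto_of_tendsto_of_monotone hmeas
      (Filter.Eventually.of_forall fun s n m hnm => ?_)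
      (Filter.Eventually.of_forall hlim)) ?_
    · refine ENNReal.ofReal_le_ofReal (sub_le_sub_left (max_le_max le_rfl ?_) _)
      exact neg_le_neg (by exact_mod_cast hnm)
    · obtain ⟨m, hm⟩ := exists_nat_ge (-C)
      filter_upwards [Filter.eventually_ge_atTop m] with n hn
      have : (m : ℝ) ≤ n := by exact_mod_cast hn
      exact hCt n (by linarith)
  have h1 : Integrable (fun s => C - φ s) μ := by
    refine ⟨(measurable_const.sub hφ).aestronglyMeasurable, ?_⟩
    rw [hasFiniteIntegral_iff_ofReal (Filter.Eventually.of_forall fun s => sub_nonneg.2 (hC s))]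
    exact hsup.trans_lt ENNReal.ofReal_lt_top
  have h2 : Integrable φ μ := by
    refine ((integrable_const C).sub h1).congr (Filter.Eventually.of_forall fun s => ?_)
    simp
  refine ⟨h2, ?_⟩
  by_cases hCt' : 0 ≤ C - t
  · rw [← ofReal_integral_eq_lintegral_ofReal h1
      (Filter.Eventually.of_forall fun s => sub_nonneg.2 (hC s)),
      ENNReal.ofReal_le_ofReal_iff hCt', integral_sub (integrable_const C) h2] at hsup
    simp only [integral_const, probReal_univ, smul_eq_mul, one_mul] at hsup
    linarith
  · exfalso
    obtain ⟨m, hm⟩ := exists_nat_ge (-C)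
    have h3 : ∫ s, max (φ s) (-m : ℝ) ∂μ ≤ ∫ _, C ∂μ :=
      integral_mono (hint m) (integrable_const C) fun s => max_le (hC s) (by linarith)
    simp only [integral_const, probReal_univ, smul_eq_mul, one_mul] at h3
    linarith [ht m]

end Expectation


/-! ### Couplings with an empirical measure -/

section Couplings

variable {X Y : Type*} [MeasurableSpace X] [MeasurableSpace Y] {N : ℕ}

/-- The pair of a point `(x, y)` and the sample point of index `i`. -/
def pairWithSample (z : Fin N → X × Y) (p : X × (Y × Fin N)) : (X × Y) × (X × Y) :=
  ((p.1, p.2.1), z p.2.2)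

lemma measurable_pairWithSample (z : Fin N → X × Y) : Measurable (pairWithSample z) :=
  (measurable_fst.prodMk (measurable_fst.comp measurable_snd)).prodMk
    ((measurable_of_finite z).comp (measurable_snd.comp measurable_snd))

lemma measurable_sampleIndex : Measurable fun p : X × (Y × Fin N) => p.2.2 :=
  measurable_snd.comp measurable_snd

/-- A coupling with the empirical measure comes from a measure that also remembers the index of
the sample point, each index having probability `1 / N`. Sample points that occur several times
share their mass equally. -/
lemma exists_plan_of_coupling [MeasurableSingletonClass X] [MeasurableSingletonClass Y]
    {z : Fin N → X × Y} {μ : Measure (X × Y)} {π : Measure ((X × Y) × (X × Y))}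
    (hπ : π ∈ couplings μ (empirical z)) :
    ∃ ρ : Measure (X × (Y × Fin N)), ρ.map (pairWithSample z) = π ∧
      ∀ i, ρ ((fun p => p.2.2) ⁻¹' {i}) = (N : ℝ≥0∞)⁻¹ := by
  classical
  let m : Fin N → ℕ := fun i => (Finset.univ.filter fun k => z k = z i).card
  have hm : ∀ i, (m i : ℝ≥0∞) ≠ 0 := fun i => by
    simp only [m, Ne, Nat.cast_eq_zero, Finset.card_eq_zero]
    exact Finset.ne_empty_of_mem (Finset.mem_filter.2 ⟨Finset.mem_univ i, rfl⟩)
  let A : Fin N → Set ((X × Y) × (X × Y)) := fun i => Prod.snd ⁻¹' {z i}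
  have hA : ∀ i, MeasurableSet (A i) := fun i => measurable_snd (measurableSet_singleton _)
  let g : Fin N → (X × Y) × (X × Y) → X × (Y × Fin N) := fun i p => (p.1.1, (p.1.2, i))
  have hg : ∀ i, Measurable (g i) := fun i =>
    (measurable_fst.comp measurable_fst).prodMk
      ((measurable_snd.comp measurable_fst).prodMk measurable_const)
  let ρ : Measure (X × (Y × Fin N)) := ∑ i, (m i : ℝ≥0∞)⁻¹ • (π.restrict (A i)).map (g i)
  have hρ : ∀ E, MeasurableSet E → ρ E = ∑ i, (m i : ℝ≥0∞)⁻¹ * π (g i ⁻¹' E ∩ A i) := by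
    intro E hE
    simp only [ρ, Measure.coe_finsetSum, Finset.sum_apply, Measure.smul_apply, smul_eq_mul]
    refine Finset.sum_congr rfl fun i _ => ?_
    rw [Measure.map_apply (hg i) hE, Measure.restrict_apply (hg i hE)]
  have hempirical : ∀ B, MeasurableSet B →
      π (Prod.snd ⁻¹' B) = (N : ℝ≥0∞)⁻¹ * ∑ i, B.indicator 1 (z i) := by
    intro B hB
    rw [← Measure.map_apply measurable_snd hB, hπ.2]
    simp [empirical, Measure.dirac_apply' _ hB]
  have hrange : ∀ᵐ p ∂π, p.2 ∈ Set.range z := by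
    have h1 := hempirical (Set.range z)ᶜ (Set.finite_range z).measurableSet.compl
    rw [ae_iff]
    refine Eq.trans (congrArg π (Set.ext fun p => Iff.rfl)) (h1.trans ?_)
    simp
  refine ⟨ρ, Measure.ext fun E hE => ?_, fun i => ?_⟩
  · rw [Measure.map_apply (measurable_pairWithSample z) hE,
      hρ _ (measurable_pairWithSample z hE)]
    have h1 : ∀ i, g i ⁻¹' (pairWithSample z ⁻¹' E) ∩ A i = E ∩ A i := by
      intro i
      ext ⟨w, w'⟩
      simp only [Set.mem_inter_iff, Set.mem_preimage, A, Set.mem_singleton_iff, g, pairWithSample]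
      constructor <;> rintro ⟨h, rfl⟩ <;> exact ⟨h, rfl⟩
    simp only [h1]
    calc ∑ i, (m i : ℝ≥0∞)⁻¹ * π (E ∩ A i)
        = ∑ i, ∫⁻ p, (m i : ℝ≥0∞)⁻¹ * (E ∩ A i).indicator 1 p ∂π := by
          refine Finset.sum_congr rfl fun i _ => ?_
          rw [lintegral_const_mul _ (measurable_one.indicator (hE.inter (hA i))),
            lintegral_indicator_one (hE.inter (hA i))]
      _ = ∫⁻ p, ∑ i, (m i : ℝ≥0∞)⁻¹ * (E ∩ A i).indicator 1 p ∂π :=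
          (lintegral_finsetSum _ fun i _ =>
            (measurable_one.indicator (hE.inter (hA i))).const_mul _).symm
      _ = ∫⁻ p, E.indicator 1 p ∂π := by
          refine lintegral_congr_ae ?_
          filter_upwards [hrange] with p hp
          obtain ⟨i₀, hi₀⟩ := hp
          by_cases hpE : p ∈ E
          · have h2 : ∀ i, (m i : ℝ≥0∞)⁻¹ * (E ∩ A i).indicator 1 p
                = if z i = z i₀ then (m i₀ : ℝ≥0∞)⁻¹ else 0 := by
              intro i
              by_cases hi : z i = z i₀
              · have hpA : p ∈ E ∩ A i := ⟨hpE, by simp [A, hi, hi₀]⟩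
                simp [hpA, hi, m]
              · have hpA : p ∉ E ∩ A i := fun h => hi (by
                  have h3 : p.2 = z i := h.2
                  rw [← h3, hi₀])
                simp [Set.indicator_of_notMem hpA, hi]
            simp only [h2, ← Finset.sum_filter, Finset.sum_const, nsmul_eq_mul]
            rw [Set.indicator_of_mem hpE, Pi.one_apply]
            exact ENNReal.mul_inv_cancel (hm i₀) (ENNReal.natCast_ne_top _)
          · have hpA : ∀ i, p ∉ E ∩ A i := fun i h => hpE h.1
            simp [hpE]
      _ = π E := lintegral_indicator_one hE
  · rw [hρ _ (measurable_sampleIndex (measurableSet_singleton i))]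
    have h1 : ∀ k, k ≠ i → π (g k ⁻¹' ((fun p => p.2.2) ⁻¹' {i}) ∩ A k) = 0 := by
      intro k hk
      convert measure_empty (μ := π) using 2
      ext p
      simp [g, hk]
    have h2 : g i ⁻¹' ((fun p => p.2.2) ⁻¹' {i}) ∩ A i = A i := by
      ext p
      simp [g]
    rw [Finset.sum_eq_single i (fun k _ hk => by rw [h1 k hk, mul_zero]) (by simp), h2,
      hempirical _ (measurableSet_singleton _)]
    have h3 : ∑ k, ({z i} : Set (X × Y)).indicator (1 : X × Y → ℝ≥0∞) (z k) = m i := by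
      simp [Set.indicator_apply, m]
    rw [h3, mul_left_comm, ENNReal.inv_mul_cancel (hm i) (ENNReal.natCast_ne_top _), mul_one]

/-- A measure that gives each sample index the probability `1 / N` induces a coupling with the
empirical measure. -/
lemma map_pairWithSample_mem_couplings {z : Fin N → X × Y} {ρ : Measure (X × (Y × Fin N))}
    (hρ : ∀ i, ρ ((fun p => p.2.2) ⁻¹' {i}) = (N : ℝ≥0∞)⁻¹) :
    ρ.map (pairWithSample z) ∈
      couplings (ρ.map fun p => (p.1, p.2.1)) (empirical z) := by
  refine ⟨?_, ?_⟩
  · rw [Measure.map_map measurable_fst (measurable_pairWithSample z)]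
    rfl
  · rw [Measure.map_map measurable_snd (measurable_pairWithSample z)]
    have h1 : Prod.snd ∘ pairWithSample z = z ∘ fun p : X × (Y × Fin N) => p.2.2 := rfl
    rw [h1, ← Measure.map_map (measurable_of_finite z) measurable_sampleIndex]
    refine Measure.ext fun B hB => ?_
    rw [Measure.map_apply (measurable_of_finite z) hB,
      ← Measure.sum_smul_dirac (ρ.map fun p => p.2.2)]
    simp only [Measure.sum_fintype, Measure.map_apply measurable_sampleIndex
      (measurableSet_singleton _), hρ, empirical, ← Finset.smul_sum, Measure.smul_apply,
      Measure.coe_finsetSum, Finset.sum_apply, Measure.dirac_apply' _ hB,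
      Measure.dirac_apply' _ (measurable_of_finite z hB)]
    rfl

end Couplings

/-! ### Penalties and the dual maximum -/

section Penalty

lemma integral_comp_fintype {S J : Type*} [MeasurableSpace S] [MeasurableSpace J] [Fintype J]
    [MeasurableSingletonClass J] {ρ : Measure S} [IsFiniteMeasure ρ] {f : S → J}
    (hf : Measurable f) (b : J → ℝ) :
    ∫ s, b (f s) ∂ρ = ∑ j, b j * ρ.real (f ⁻¹' {j}) := by
  rw [← integral_map (f := b) hf.aemeasurable (measurable_of_finite b).aestronglyMeasurable,
    integral_fintype Integrable.of_finite]
  refine Finset.sum_congr rfl fun j _ => ?_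
  rw [map_measureReal_apply hf (measurableSet_singleton j), smul_eq_mul, mul_comm]

variable {X Y : Type*} {N : ℕ}

/-- The price of the transport of mass from `z i` to `(x, y)` under the dual variables. -/
def penalty (c : (X × Y) × (X × Y) → ℝ) (z : Fin N → X × Y) (d : DualVar Y N)
    (p : X × (Y × Fin N)) : ℝ :=
  d.α * c (pairWithSample z p) + d.β p.2.2 + (d.lamU p.2.1 - d.lamL p.2.1)

variable {c : (X × Y) × (X × Y) → ℝ} {z : Fin N → X × Y} {L : X × Y → ℝ} {d : DualVar Y N}

lemma le_dualMax [Finite Y] (p : X × (Y × Fin N)) :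
    L (p.1, p.2.1) - penalty c z d p ≤ dualMax c z L d p.1 := by
  have h := le_ciSup (f := fun q : Y × Fin N =>
    L (p.1, q.1) - (d.α * c ((p.1, q.1), z q.2) + d.β q.2) - (d.lamU q.1 - d.lamL q.1))
    (Set.finite_range _).bddAbove p.2
  refine le_trans (le_of_eq ?_) h
  simp only [penalty, pairWithSample]
  ring

lemma dualMax_le [Nonempty Y] [NeZero N] {x : X} {t : ℝ}
    (h : ∀ j : Y × Fin N, L (x, j.1) - penalty c z d (x, j) ≤ t) : dualMax c z L d x ≤ t := by
  refine ciSup_le fun j => le_trans (le_of_eq ?_) (h j)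
  simp only [penalty, pairWithSample]
  ring

/-- The size of the dual variables, relative to a bound for the cost: it bounds the penalty. -/
def DualVar.size [Fintype Y] (d : DualVar Y N) (C : ℝ) : ℝ :=
  |d.α| * C + ∑ i, |d.β i| + ∑ y, |d.lamU y - d.lamL y|

lemma abs_penalty_le [Fintype Y] {C : ℝ} (hc0 : ∀ p, 0 ≤ c p) (hcC : ∀ p, c p ≤ C)
    (p : X × (Y × Fin N)) : |penalty c z d p| ≤ d.size C := by
  refine (abs_add_three _ _ _).trans (add_le_add_three ?_ ?_ ?_)
  · rw [abs_mul, abs_of_nonneg (hc0 _)]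
    exact mul_le_mul_of_nonneg_left (hcC _) (abs_nonneg _)
  · exact Finset.single_le_sum (f := fun i => |d.β i|) (fun i _ => abs_nonneg _)
      (Finset.mem_univ p.2.2)
  · exact Finset.single_le_sum (f := fun y => |d.lamU y - d.lamL y|) (fun i _ => abs_nonneg _)
      (Finset.mem_univ p.2.1)

variable [MeasurableSpace X] [MeasurableSpace Y]

lemma measurable_penalty [Finite Y] [MeasurableSingletonClass Y] (hc : Measurable c) :
    Measurable (penalty c z d) := by
  refine ((measurable_const.mul (hc.comp (measurable_pairWithSample z))).add
    ((measurable_of_finite d.β).comp measurable_sampleIndex)).add ?_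
  exact (measurable_of_finite fun y => d.lamU y - d.lamL y).comp
    (measurable_fst.comp measurable_snd)

lemma measurable_dualMax [Finite Y] [MeasurableSingletonClass Y] (hc : Measurable c)
    (hL : Measurable L) : Measurable (dualMax c z L d) := by
  refine Measurable.iSup fun j => ?_
  refine ((hL.comp (measurable_id.prodMk measurable_const)).sub ?_).sub measurable_const
  exact ((hc.comp ((measurable_id.prodMk measurable_const).prodMk
    measurable_const)).const_mul _).add_const _

lemma integral_penalty [Fintype Y] [MeasurableSingletonClass Y] {C : ℝ} (hc : Measurable c)
    (hc0 : ∀ p, 0 ≤ c p) (hcC : ∀ p, c p ≤ C) (ρ : Measure (X × (Y × Fin N)))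
    [IsFiniteMeasure ρ] :
    ∫ p, penalty c z d p ∂ρ = d.α * ∫ p, c (pairWithSample z p) ∂ρ
      + ∑ i, d.β i * ρ.real ((fun p => p.2.2) ⁻¹' {i})
      + ∑ y, (d.lamU y - d.lamL y) * ρ.real ((fun p => p.2.1) ⁻¹' {y}) := by
  have h1 : Integrable (fun p => c (pairWithSample z p)) ρ :=
    Integrable.of_bound (hc.comp (measurable_pairWithSample z)).aestronglyMeasurable C
      (Filter.Eventually.of_forall fun p => by
        rw [Real.norm_of_nonneg (hc0 _)]; exact hcC _)
  have h2 : Integrable (fun p : X × (Y × Fin N) => d.β p.2.2) ρ :=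
    Integrable.of_bound ((measurable_of_finite d.β).comp
      measurable_sampleIndex).aestronglyMeasurable (∑ i, |d.β i|)
      (Filter.Eventually.of_forall fun p => Finset.single_le_sum (f := fun i => |d.β i|)
        (fun i _ => abs_nonneg _) (Finset.mem_univ p.2.2))
  have hm : Measurable fun p : X × (Y × Fin N) => p.2.1 := measurable_fst.comp measurable_snd
  have h3 : Integrable (fun p : X × (Y × Fin N) => d.lamU p.2.1 - d.lamL p.2.1) ρ :=
    Integrable.of_bound ((measurable_of_finite fun y => d.lamU y - d.lamL y).comp
      hm).aestronglyMeasurable (∑ y, |d.lamU y - d.lamL y|)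
      (Filter.Eventually.of_forall fun p => Finset.single_le_sum
        (f := fun y => |d.lamU y - d.lamL y|)
        (fun i _ => abs_nonneg _) (Finset.mem_univ p.2.1))
  simp only [penalty]
  rw [integral_add (f := fun p => d.α * c (pairWithSample z p) + d.β p.2.2)
    ((h1.const_mul _).add h2) h3, integral_add (h1.const_mul _) h2,
    integral_const_mul, integral_comp_fintype measurable_sampleIndex,
    integral_comp_fintype hm fun y => d.lamU y - d.lamL y]

/-- Weak duality for a single plan: the dual maximum dominates the penalized loss. -/
lemma integral_sub_penalty_le [Fintype Y] [MeasurableSingletonClass Y] [Nonempty Y] [NeZero N]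
    {C M : ℝ} (hc : Measurable c) (hc0 : ∀ p, 0 ≤ c p) (hcC : ∀ p, c p ≤ C)
    (hL : Measurable L) (hLM : ∀ w, L w ≤ M) {PX : Measure X}
    {ρ : Measure (X × (Y × Fin N))} [IsProbabilityMeasure ρ] (hρ : ρ.map Prod.fst = PX)
    (hint : Integrable (fun p => L (p.1, p.2.1)) ρ) :
    Integrable (dualMax c z L d) PX ∧
      ∫ p, L (p.1, p.2.1) ∂ρ - ∫ p, penalty c z d p ∂ρ ≤ ∫ x, dualMax c z L d x ∂PX := by
  have hpen : Integrable (penalty c z d) ρ :=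
    Integrable.of_bound (measurable_penalty hc).aestronglyMeasurable (d.size C)
      (Filter.Eventually.of_forall fun p => abs_penalty_le hc0 hcC p)
  have hD := measurable_dualMax (z := z) (d := d) hc hL
  have hint' := hint.sub hpen
  have hD' : Integrable (dualMax c z L d ∘ Prod.fst) ρ := by
    refine (hint'.norm.add (integrable_const |M + d.size C|)).mono'
      (hD.comp measurable_fst).aestronglyMeasurable (Filter.Eventually.of_forall fun p => ?_)
    have h1 := le_dualMax (c := c) (z := z) (L := L) (d := d) p
    have h2 : dualMax c z L d p.1 ≤ M + d.size C := dualMax_le fun j => by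
      have h3 := (abs_le.1 (abs_penalty_le (d := d) (z := z) hc0 hcC (p.1, j))).1
      linarith [hLM (p.1, j.1)]
    simp only [Pi.add_apply, Pi.sub_apply, Function.comp, Real.norm_eq_abs]
    have h4 := neg_abs_le (L (p.1, p.2.1) - penalty c z d p)
    have h5 := abs_nonneg (M + d.size C)
    have h6 := le_abs_self (M + d.size C)
    have h7 := abs_nonneg (L (p.1, p.2.1) - penalty c z d p)
    exact abs_le.2 ⟨by linarith, by linarith⟩
  have hDP : Integrable (dualMax c z L d) PX := by
    rw [← hρ]
    exact (integrable_map_measure hD.aestronglyMeasurable measurable_fst.aemeasurable).2 hD'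
  refine ⟨hDP, ?_⟩
  rw [← hρ, integral_map measurable_fst.aemeasurable hD.aestronglyMeasurable,
    ← integral_sub hint hpen]
  exact integral_mono hint' hD' fun p => le_dualMax p

end Penalty


/-! ### Plans and the decision set -/

section Plans

variable {X Y : Type*} [MeasurableSpace X] [MeasurableSpace Y] {N : ℕ}

/-- The plans of the adversary: measures on `X × (Y × Fin N)` with the prescribed `X`-marginal,
label probabilities in the prescribed intervals, and sample indices that are uniformly distributed.
They are the couplings with the empirical measure in a form in which all but the first coordinate
take finitely many values. -/
structure IsPlan (PX : Measure X) (pL pU : Y → ℝ) (ρ : Measure (X × (Y × Fin N))) : Prop where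
  map_fst : ρ.map Prod.fst = PX
  label : ∀ y, ρ.real ((fun p => p.2.1) ⁻¹' {y}) ∈ Set.Icc (pL y) (pU y)
  index : ∀ i, ρ.real ((fun p => p.2.2) ⁻¹' {i}) = 1 / (N : ℝ)

lemma isProbabilityMeasure_of_map_fst {J : Type*} [MeasurableSpace J] {PX : Measure X}
    [IsProbabilityMeasure PX] {ρ : Measure (X × J)} (h : ρ.map Prod.fst = PX) :
    IsProbabilityMeasure ρ := by
  refine ⟨?_⟩
  rw [← Set.preimage_univ (f := Prod.fst), ← Measure.map_apply measurable_fst MeasurableSet.univ, h,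
    measure_univ]

lemma measurable_dropIndex : Measurable fun p : X × (Y × Fin N) => (p.1, p.2.1) :=
  measurable_fst.prodMk (measurable_fst.comp measurable_snd)

lemma labelProb_map [MeasurableSingletonClass Y] (ρ : Measure (X × (Y × Fin N))) (y : Y) :
    labelProb (ρ.map fun p => (p.1, p.2.1)) y = ρ.real ((fun p => p.2.1) ⁻¹' {y}) := by
  rw [labelProb, map_measureReal_apply measurable_dropIndex
    (MeasurableSet.univ.prod (measurableSet_singleton y))]
  congr 1
  ext p
  simp

lemma lintegral_cost_eq {c : (X × Y) × (X × Y) → ℝ} (hc : Measurable c) (hc0 : ∀ p, 0 ≤ c p)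
    {C : ℝ} (hcC : ∀ p, c p ≤ C) (z : Fin N → X × Y) (ρ : Measure (X × (Y × Fin N)))
    [IsFiniteMeasure ρ] :
    ∫⁻ p, ENNReal.ofReal (c p) ∂(ρ.map (pairWithSample z)) =
      ENNReal.ofReal (∫ p, c (pairWithSample z p) ∂ρ) := by
  rw [lintegral_map hc.ennreal_ofReal (measurable_pairWithSample z),
    ofReal_integral_eq_lintegral_ofReal _ (Filter.Eventually.of_forall fun p => hc0 _)]
  exact Integrable.of_bound (hc.comp (measurable_pairWithSample z)).aestronglyMeasurable C
    (Filter.Eventually.of_forall fun p => by rw [Real.norm_of_nonneg (hc0 _)]; exact hcC _)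

lemma IsPlan.map_mem_decisionSet [MeasurableSingletonClass Y] {PX : Measure X}
    [IsProbabilityMeasure PX] {pL pU : Y → ℝ}
    {ρ : Measure (X × (Y × Fin N))} (hρ : IsPlan PX pL pU ρ)
    {c : (X × Y) × (X × Y) → ℝ} (hc : Measurable c) (hc0 : ∀ p, 0 ≤ c p)
    {C : ℝ} (hcC : ∀ p, c p ≤ C) {z : Fin N → X × Y} {ε : ℝ}
    (hε : ∫ p, c (pairWithSample z p) ∂ρ ≤ ε) :
    (ρ.map fun p => (p.1, p.2.1)) ∈ decisionSet PX pL pU c ε z := by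
  have hprob := isProbabilityMeasure_of_map_fst hρ.map_fst
  refine ⟨⟨?_, fun y => ?_⟩, Measure.isProbabilityMeasure_map measurable_dropIndex.aemeasurable, ?_⟩
  · rw [Measure.map_map measurable_fst measurable_dropIndex]
    exact hρ.map_fst
  · rw [labelProb_map]
    exact hρ.label y
  · have hmem : ρ.map (pairWithSample z) ∈
        couplings (ρ.map fun p => (p.1, p.2.1)) (empirical z) := by
      refine map_pairWithSample_mem_couplings fun i => ?_
      rw [← ofReal_measureReal, hρ.index i]
      have hN : 0 < N := i.pos
      rw [one_div, ENNReal.ofReal_inv_of_pos (by exact_mod_cast hN), ENNReal.ofReal_natCast]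
    have h1 : wasserstein c (ρ.map fun p => (p.1, p.2.1)) (empirical z) ≤
        ENNReal.ofReal (∫ p, c (pairWithSample z p) ∂ρ) :=
      (iInf₂_le _ hmem).trans_eq (lintegral_cost_eq hc hc0 hcC z ρ)
    refine (EReal.coe_ennreal_le_coe_ennreal_iff.2 h1).trans ?_
    rw [EReal.coe_ennreal_ofReal, max_eq_left (integral_nonneg fun p => hc0 _)]
    exact_mod_cast hε

lemma exists_isPlan_of_mem_marginalSet [MeasurableSingletonClass X] [MeasurableSingletonClass Y]
    {PX : Measure X} [IsProbabilityMeasure PX] {pL pU : Y → ℝ} {μ : Measure (X × Y)}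
    (hμ : μ ∈ marginalSet PX pL pU) {c : (X × Y) × (X × Y) → ℝ} (hc : Measurable c)
    (hc0 : ∀ p, 0 ≤ c p) {C : ℝ} (hcC : ∀ p, c p ≤ C) {z : Fin N → X × Y} {r : ℝ}
    (hr : ((wasserstein c μ (empirical z) : ℝ≥0∞) : EReal) < (r : EReal)) :
    ∃ ρ : Measure (X × (Y × Fin N)), IsPlan PX pL pU ρ ∧
      (ρ.map fun p => (p.1, p.2.1)) = μ ∧ ∫ p, c (pairWithSample z p) ∂ρ < r := by
  have hr0 : 0 < r := by
    have := (EReal.coe_ennreal_nonneg _).trans_lt hr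
    exact_mod_cast this
  have hr' : wasserstein c μ (empirical z) < ENNReal.ofReal r := by
    rw [← EReal.coe_ennreal_lt_coe_ennreal_iff, EReal.coe_ennreal_ofReal, max_eq_left hr0.le]
    exact hr
  simp only [wasserstein, iInf_lt_iff] at hr'
  obtain ⟨π, hπ, hcost⟩ := hr'
  obtain ⟨ρ, hρπ, hindex⟩ := exists_plan_of_coupling hπ
  have hμρ : (ρ.map fun p => (p.1, p.2.1)) = μ := by
    rw [← hπ.1, ← hρπ, Measure.map_map measurable_fst (measurable_pairWithSample z)]
    rfl
  have hfst : ρ.map Prod.fst = PX := by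
    rw [← hμ.1, ← hμρ, Measure.map_map measurable_fst measurable_dropIndex]
    rfl
  have hprob := isProbabilityMeasure_of_map_fst hfst
  refine ⟨ρ, ⟨hfst, fun y => ?_, fun i => ?_⟩, hμρ, ?_⟩
  · rw [← labelProb_map, hμρ]
    exact hμ.2 y
  · rw [measureReal_def, hindex i, ENNReal.toReal_inv, ENNReal.toReal_natCast, one_div]
  · rw [← hρπ, lintegral_cost_eq hc hc0 hcC z ρ] at hcost
    exact (ENNReal.ofReal_lt_ofReal_iff hr0).1 hcost

/-- The part of the dual objective that is linear in the dual variables. -/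
noncomputable def dualLinear [Fintype Y] (pL pU : Y → ℝ) (ε : ℝ) (d : DualVar Y N) : ℝ :=
  d.α * ε + (1 / (N : ℝ)) * ∑ i, d.β i + ∑ y, (d.lamU y * pU y - d.lamL y * pL y)

lemma IsPlan.integral_penalty_le [Fintype Y] [MeasurableSingletonClass Y] {PX : Measure X}
    [IsProbabilityMeasure PX] {pL pU : Y → ℝ}
    {ρ : Measure (X × (Y × Fin N))} (hρ : IsPlan PX pL pU ρ)
    {c : (X × Y) × (X × Y) → ℝ} (hc : Measurable c) (hc0 : ∀ p, 0 ≤ c p)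
    {C : ℝ} (hcC : ∀ p, c p ≤ C) {z : Fin N → X × Y} {ε : ℝ}
    (hε : ∫ p, c (pairWithSample z p) ∂ρ ≤ ε) {d : DualVar Y N} (hd : d.Feasible) :
    ∫ p, penalty c z d p ∂ρ ≤ dualLinear pL pU ε d := by
  have hprob := isProbabilityMeasure_of_map_fst hρ.map_fst
  rw [integral_penalty hc hc0 hcC, dualLinear]
  refine add_le_add_three (mul_le_mul_of_nonneg_left hε hd.1) (le_of_eq ?_)
    (Finset.sum_le_sum fun y _ => ?_)
  · rw [Finset.mul_sum]
    exact Finset.sum_congr rfl fun i _ => by rw [hρ.index i, mul_comm]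
  · have h1 := mul_le_mul_of_nonneg_left (hρ.label y).2 (hd.2.1 y)
    have h2 := mul_le_mul_of_nonneg_left (hρ.label y).1 (hd.2.2 y)
    linarith

end Plans

/-! ### Lagrange multipliers for bounded losses -/

section Duality

variable {X Y : Type*} [MeasurableSpace X] [MeasurableSpace Y] [Fintype Y]
  [MeasurableSingletonClass Y] [Nonempty Y] {N : ℕ} [NeZero N]

/-- The dual maximum is the penalized loss of the plan that moves each `x` to the best label
and sample point. -/
lemma exists_integral_sub_penalty_eq (PX : Measure X) [IsProbabilityMeasure PX]
    {c : (X × Y) × (X × Y) → ℝ} (hc : Measurable c) {L : X × Y → ℝ} (hL : Measurable L)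
    (z : Fin N → X × Y) (d : DualVar Y N) :
    ∃ ρ : Measure (X × (Y × Fin N)), ρ.map Prod.fst = PX ∧
      ∫ p, (L (p.1, p.2.1) - penalty c z d p) ∂ρ = ∫ x, dualMax c z L d x ∂PX := by
  have hmeas : Measurable fun p : X × (Y × Fin N) => L (p.1, p.2.1) - penalty c z d p :=
    (hL.comp measurable_dropIndex).sub (measurable_penalty hc)
  obtain ⟨s, hs, hmax⟩ := exists_measurable_argmax _ hmeas
  have hgraph : Measurable fun x => (x, s x) := measurable_id.prodMk hs
  refine ⟨PX.map fun x => (x, s x), ?_, ?_⟩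
  · rw [Measure.map_map measurable_fst hgraph]
    exact Measure.map_id
  · rw [integral_map hgraph.aemeasurable hmeas.aestronglyMeasurable]
    refine integral_congr_ae (Filter.Eventually.of_forall fun x => ?_)
    exact le_antisymm (le_dualMax (x, s x)) (dualMax_le fun j => hmax x j)

/-- Lagrange multipliers for a bounded loss: if all plans of cost at most `ε` have expected loss
less than `t`, some dual variables certify the bound `t`. The attainable values of the constraints
and of the expected loss form a compact convex set, which is separated from the values that would
be feasible with an expected loss of at least `t`. The existence of one feasible plan ensures that
the separating hyperplane is not vertical. -/
lemma exists_dual_le_of_forall_lt (PX : Measure X) [IsProbabilityMeasure PX]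
    {c : (X × Y) × (X × Y) → ℝ} (hc : Measurable c) (hc0 : ∀ p, 0 ≤ c p)
    {C : ℝ} (hcC : ∀ p, c p ≤ C) {L : X × Y → ℝ} (hL : Measurable L) {M : ℝ}
    (hLM : ∀ w, |L w| ≤ M) {pL pU : Y → ℝ} (hp : ∀ y, pL y ≤ pU y) (z : Fin N → X × Y) {ε t : ℝ}
    (hfeas : ∃ ρ : Measure (X × (Y × Fin N)), IsPlan PX pL pU ρ ∧
      ∫ p, c (pairWithSample z p) ∂ρ ≤ ε)
    (ht : ∀ ρ : Measure (X × (Y × Fin N)), IsPlan PX pL pU ρ →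
      ∫ p, c (pairWithSample z p) ∂ρ ≤ ε → ∫ p, L (p.1, p.2.1) ∂ρ < t) :
    ∃ d : DualVar Y N, d.Feasible ∧
      dualLinear pL pU ε d + ∫ x, dualMax c z L d x ∂PX ≤ t := by
  classical
  have hlab : Measurable fun p : X × (Y × Fin N) => p.2.1 := measurable_fst.comp measurable_snd
  let test : (Fin N ⊕ Y) ⊕ Bool → TestFun (X × (Y × Fin N)) := fun m => match m with
    | .inl (.inl i) => TestFun.indicator (measurable_sampleIndex (measurableSet_singleton i))
    | .inl (.inr y) => TestFun.indicator (hlab (measurableSet_singleton y))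
    | .inr false => ⟨fun p => c (pairWithSample z p), hc.comp (measurable_pairWithSample z), C,
        fun p => by rw [abs_of_nonneg (hc0 _)]; exact hcC _⟩
    | .inr true => ⟨fun p => L (p.1, p.2.1), hL.comp measurable_dropIndex, M, fun p => hLM _⟩
  let S : Set ((Fin N ⊕ Y) ⊕ Bool → ℝ) := {v | ∃ ρ : Measure (X × (Y × Fin N)),
    ρ.map Prod.fst = PX ∧ ∀ m, v m = ∫ p, (test m).toFun p ∂ρ}
  let B : Set ((Fin N ⊕ Y) ⊕ Bool → ℝ) := {v | (∀ i, v (.inl (.inl i)) = 1 / (N : ℝ)) ∧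
    (∀ y, v (.inl (.inr y)) ∈ Set.Icc (pL y) (pU y)) ∧ v (.inr false) ≤ ε ∧ t ≤ v (.inr true)}
  have hindex : ∀ (ρ : Measure (X × (Y × Fin N))) i, ∫ p, (test (.inl (.inl i))).toFun p ∂ρ
      = ρ.real ((fun p => p.2.2) ⁻¹' {i}) := fun ρ i => by
    simp [test, TestFun.indicator, integral_indicator (measurable_sampleIndex
      (measurableSet_singleton i))]
  have hlabel : ∀ (ρ : Measure (X × (Y × Fin N))) y, ∫ p, (test (.inl (.inr y))).toFun p ∂ρ
      = ρ.real ((fun p => p.2.1) ⁻¹' {y}) := fun ρ y => by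
    simp [test, TestFun.indicator, integral_indicator (hlab (measurableSet_singleton y))]
  have hScompact : IsCompact S := by
    have hcont : Continuous fun (v : TestFun (X × (Y × Fin N)) → ℝ) m => v (test m) :=
      continuous_pi fun m => continuous_apply _
    convert (isCompact_integrals_of_marginal (J := Y × Fin N) PX).image hcont using 1
    ext v
    constructor
    · rintro ⟨ρ, hρ, hv⟩
      exact ⟨fun a => ∫ p, a.toFun p ∂ρ, ⟨ρ, hρ, fun a => rfl⟩, funext fun m => (hv m).symm⟩
    · rintro ⟨w, ⟨ρ, hρ, hw⟩, rfl⟩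
      exact ⟨ρ, hρ, fun m => hw _⟩
  have hSconvex : Convex ℝ S := by
    rintro v ⟨ρ, hρ, hv⟩ w ⟨σ, hσ, hw⟩ a b ha hb hab
    have h1 := isProbabilityMeasure_of_map_fst hρ
    have h2 := isProbabilityMeasure_of_map_fst hσ
    refine ⟨a.toNNReal • ρ + b.toNNReal • σ, ?_, fun m => ?_⟩
    · rw [Measure.map_add _ _ measurable_fst, Measure.map_smul, Measure.map_smul, hρ, hσ,
        ← add_smul, ← Real.toNNReal_add ha hb, hab, Real.toNNReal_one, one_smul]
    · rw [integral_add_measure (((test m).integrable ρ).smul_measure_nnreal)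
        (((test m).integrable σ).smul_measure_nnreal), integral_smul_nnreal_measure,
        integral_smul_nnreal_measure, ← hv m, ← hw m]
      simp [NNReal.smul_def, ha, hb]
  have hBclosed : IsClosed B := by
    have h1 : B = (⋂ i, {v | v (.inl (.inl i)) = 1 / (N : ℝ)}) ∩
        ((⋂ y, {v | v (.inl (.inr y)) ∈ Set.Icc (pL y) (pU y)}) ∩
          ({v | v (.inr false) ≤ ε} ∩ {v | t ≤ v (.inr true)})) := by
      ext v
      simp [B]
    rw [h1]
    refine (isClosed_iInter fun i => isClosed_eq (continuous_apply _) continuous_const).inter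
      ((isClosed_iInter fun y => isClosed_Icc.preimage (continuous_apply _)).inter
        ((isClosed_le (continuous_apply _) continuous_const).inter
          (isClosed_le continuous_const (continuous_apply _))))
  have hBconvex : Convex ℝ B := by
    rintro v ⟨h1, h2, h3, h4⟩ w ⟨k1, k2, k3, k4⟩ a b ha hb hab
    refine ⟨fun i => ?_, fun y => ?_, ?_, ?_⟩
    · simp only [Pi.add_apply, Pi.smul_apply, smul_eq_mul, h1, k1]
      rw [← add_mul, hab, one_mul]
    · exact (convex_Icc (pL y) (pU y)) (h2 y) (k2 y) ha hb hab
    · exact (convex_Iic ε) h3 k3 ha hb hab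
    · exact (convex_Ici t) h4 k4 ha hb hab
  have hplan : ∀ ρ : Measure (X × (Y × Fin N)), ρ.map Prod.fst = PX →
      (fun m => ∫ p, (test m).toFun p ∂ρ) ∈ S := fun ρ hρ => ⟨ρ, hρ, fun m => rfl⟩
  have hdisj : Disjoint S B := by
    rw [Set.disjoint_left]
    rintro v ⟨ρ, hρ, hv⟩ ⟨h1, h2, h3, h4⟩
    simp only [hv, hindex] at h1
    simp only [hv, hlabel] at h2
    rw [hv] at h3 h4
    exact (ht ρ ⟨hρ, h2, h1⟩ h3).not_ge h4
  obtain ⟨f, u, u', hfS, huu', hfB⟩ :=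
    geometric_hahn_banach_compact_closed hSconvex hScompact hBconvex hBclosed hdisj
  have hSB : ∀ a ∈ S, ∀ b ∈ B, f a < f b := fun a ha b hb =>
    (hfS a ha).trans (huu'.trans (hfB b hb))
  obtain ⟨w, hw⟩ : ∃ w : (Fin N ⊕ Y) ⊕ Bool → ℝ, ∀ v, f v =
      ∑ i, w (.inl (.inl i)) * v (.inl (.inl i)) + ∑ y, w (.inl (.inr y)) * v (.inl (.inr y))
        + w (.inr false) * v (.inr false) + w (.inr true) * v (.inr true) := by
    refine ⟨fun m => f (Pi.single m 1), fun v => ?_⟩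
    have h1 := LinearMap.pi_apply_eq_sum_univ (f : ((Fin N ⊕ Y) ⊕ Bool → ℝ) →ₗ[ℝ] ℝ) v
    simp only [ContinuousLinearMap.coe_coe, smul_eq_mul] at h1
    have h2 : ∀ m : (Fin N ⊕ Y) ⊕ Bool,
        (fun j => if m = j then (1 : ℝ) else 0) = Pi.single m 1 := fun m => by
      ext j
      simp [Pi.single_apply, eq_comm]
    simp only [h2, Fintype.sum_sum_type, Fintype.sum_bool] at h1
    rw [h1]
    simp only [mul_comm]
    ring
  -- The feasible plan gives the hyperplane a positive slope in the direction of the loss.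
  obtain ⟨ρ₀, hρ₀, hcost₀⟩ := hfeas
  have hloss₀ := ht ρ₀ hρ₀ hcost₀
  let a₀ : (Fin N ⊕ Y) ⊕ Bool → ℝ := fun m => ∫ p, (test m).toFun p ∂ρ₀
  have ha₀ : a₀ ∈ S := hplan ρ₀ hρ₀.map_fst
  have hB₀ : ∀ r, 0 ≤ r →
      Function.update (Function.update a₀ (.inr true) t) (.inr false) (a₀ (.inr false) - r) ∈ B := by
    intro r hr
    refine ⟨fun i => ?_, fun y => ?_, ?_, ?_⟩
    · simpa [a₀, hindex] using hρ₀.index i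
    · simpa [a₀, hlabel] using hρ₀.label y
    · simp only [Function.update_self]
      have : a₀ (.inr false) ≤ ε := hcost₀
      linarith
    · simp
  have hslope : ∀ r, 0 ≤ r →
      w (.inr false) * r < w (.inr true) * (t - a₀ (.inr true)) := by
    intro r hr
    have h1 := hSB a₀ ha₀ _ (hB₀ r hr)
    rw [hw, hw] at h1
    simp only [Function.update_self, ne_eq, reduceCtorEq, not_false_eq_true, Function.update_of_ne,
      Sum.inr.injEq, Bool.true_eq_false] at h1
    linarith
  have hgap : 0 < t - a₀ (.inr true) := sub_pos.2 hloss₀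
  have hτ : 0 < w (.inr true) := by
    have h1 := hslope 0 le_rfl
    rw [mul_zero] at h1
    exact (pos_iff_pos_of_mul_pos h1).2 hgap
  have hα : w (.inr false) ≤ 0 := by
    by_contra! hpos
    have h1 := hslope (w (.inr true) * (t - a₀ (.inr true)) / w (.inr false)) (by positivity)
    rw [mul_div_cancel₀ _ hpos.ne'] at h1
    exact lt_irrefl _ h1
  let τ := w (.inr true)
  let lam : Y → ℝ := fun y => -w (.inl (.inr y)) / τ
  let d : DualVar Y N := ⟨-w (.inr false) / τ, fun i => -w (.inl (.inl i)) / τ,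
    fun y => max (lam y) 0, fun y => max (-lam y) 0⟩
  have hlam : ∀ y, d.lamU y - d.lamL y = lam y := fun y => max_zero_sub_max_neg_zero_eq_self _
  refine ⟨d, ⟨div_nonneg (neg_nonneg.2 hα) hτ.le, fun y => le_max_right _ _,
    fun y => le_max_right _ _⟩, ?_⟩
  obtain ⟨ρ, hρ, hρd⟩ := exists_integral_sub_penalty_eq PX hc hL z d
  have hprob := isProbabilityMeasure_of_map_fst hρ
  -- The point of `B` that is extremal for the multipliers.
  let b : (Fin N ⊕ Y) ⊕ Bool → ℝ := Sum.elim
    (Sum.elim (fun _ => 1 / (N : ℝ)) fun y => if 0 ≤ lam y then pU y else pL y)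
    (fun k => if k then t else ε)
  have hb : b ∈ B := by
    refine ⟨fun i => rfl, fun y => ?_, le_rfl, le_rfl⟩
    simp only [b, Sum.elim_inl, Sum.elim_inr]
    split_ifs
    · exact ⟨hp y, le_rfl⟩
    · exact ⟨le_rfl, hp y⟩
  have hmain := hSB _ (hplan ρ hρ) b hb
  rw [hw, hw] at hmain
  have hint : Integrable (fun p : X × (Y × Fin N) => L (p.1, p.2.1)) ρ :=
    (test (.inr true)).integrable ρ
  have hpen : Integrable (penalty c z d) ρ :=
    Integrable.of_bound (measurable_penalty hc).aestronglyMeasurable (d.size C)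
      (Filter.Eventually.of_forall fun p => abs_penalty_le hc0 hcC p)
  rw [← hρd, integral_sub hint hpen, integral_penalty hc hc0 hcC, dualLinear]
  simp only [hindex, hlabel] at hmain
  have e1 : ∀ y, d.lamU y * pU y - d.lamL y * pL y = lam y * b (.inl (.inr y)) := by
    intro y
    simp only [d, b, Sum.elim_inl, Sum.elim_inr]
    split_ifs with hy
    · rw [max_eq_left hy, max_eq_right (neg_nonpos.2 hy)]; ring
    · rw [max_eq_right (not_le.1 hy).le, max_eq_left (neg_nonneg.2 (not_le.1 hy).le)]; ring
  simp only [e1, hlam]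
  have hτ' : τ ≠ 0 := hτ.ne'
  have e2 : ∀ (i : Fin N), w (.inl (.inl i)) = -τ * d.β i := fun i => by
    simp only [d]; field_simp
  have e3 : ∀ y, w (.inl (.inr y)) = -τ * lam y := fun y => by
    simp only [lam]; field_simp
  have e4 : w (.inr false) = -τ * d.α := by
    simp only [d]; field_simp
  simp only [e2, e3, e4, mul_assoc, ← Finset.mul_sum] at hmain
  have e5 : b (.inr false) = ε := rfl
  have e6 : b (.inr true) = t := rfl
  have e7 : ∀ i, b (.inl (.inl i)) = 1 / (N : ℝ) := fun i => rfl
  have e8 : (∫ p, (test (.inr false)).toFun p ∂ρ) = ∫ p, c (pairWithSample z p) ∂ρ := rfl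
  have e9 : (∫ p, (test (.inr true)).toFun p ∂ρ) = ∫ p, L (p.1, p.2.1) ∂ρ := rfl
  have e10 : w (.inr true) = τ := rfl
  simp only [e5, e6, e7, e8, e9, e10, ← Finset.sum_mul] at hmain
  refine le_of_mul_le_mul_left ?_ hτ
  linarith

end Duality


/-! ### Equality of the primal and dual values -/

section StrongDuality

lemma dualObjective_of_integrable {X Y : Type*} [MeasurableSpace X] [Fintype Y]
    {N : ℕ} {PX : Measure X} {pL pU : Y → ℝ}
    {c : (X × Y) × (X × Y) → ℝ} {ε : ℝ} {z : Fin N → X × Y} {L : X × Y → ℝ} {d : DualVar Y N}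
    (h : Integrable (dualMax c z L d) PX) :
    dualObjective PX pL pU c ε z L d =
      ((dualLinear pL pU ε d + ∫ x, dualMax c z L d x ∂PX : ℝ) : EReal) := by
  rw [dualObjective, expect_of_integrable h, EReal.coe_add]
  rfl

variable {X Y : Type*} [MeasurableSpace X] [MeasurableSpace Y] [Fintype Y]
  [MeasurableSingletonClass Y] [Nonempty Y] {N : ℕ} [NeZero N]

/-- Weak duality. The transport cost is an infimum, so a coupling is used whose cost exceeds the
budget by an arbitrarily small amount. -/
theorem worstCase_le_dualValue [MeasurableSingletonClass X] (PX : Measure X)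
    [IsProbabilityMeasure PX]
    {c : (X × Y) × (X × Y) → ℝ} (hc : Measurable c) (hc0 : ∀ p, 0 ≤ c p)
    {C : ℝ} (hcC : ∀ p, c p ≤ C) {L : X × Y → ℝ} (hL : Measurable L) {M : ℝ}
    (hLM : ∀ w, L w ≤ M) (pL pU : Y → ℝ) (z : Fin N → X × Y) (ε : ℝ) :
    worstCase PX pL pU c ε z L ≤ dualValue PX pL pU c ε z L := by
  refine iSup₂_le fun μ hμ => le_iInf₂ fun d hd => ?_
  have hμprob := hμ.2.1
  by_cases hint : Integrable L μ
  swap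
  · rw [expect_eq_bot hL hLM hint]
    exact bot_le
  rw [expect_of_integrable hint]
  have key : ∀ δ > 0, Integrable (dualMax c z L d) PX ∧
      ∫ w, L w ∂μ ≤ dualLinear pL pU ε d + ∫ x, dualMax c z L d x ∂PX + d.α * δ := by
    intro δ hδ
    have hlt : ((wasserstein c μ (empirical z) : ℝ≥0∞) : EReal) < ((ε + δ : ℝ) : EReal) :=
      hμ.2.2.trans_lt (by exact_mod_cast lt_add_of_pos_right ε hδ)
    obtain ⟨ρ, hρ, hρμ, hcost⟩ := exists_isPlan_of_mem_marginalSet hμ.1 hc hc0 hcC hlt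
    have hprob := isProbabilityMeasure_of_map_fst hρ.map_fst
    have hintρ : Integrable (fun p => L (p.1, p.2.1)) ρ := by
      rw [← hρμ] at hint
      exact (integrable_map_measure hL.aestronglyMeasurable measurable_dropIndex.aemeasurable).1 hint
    obtain ⟨h1, h2⟩ := integral_sub_penalty_le (z := z) (d := d) hc hc0 hcC hL hLM hρ.map_fst hintρ
    have h3 := hρ.integral_penalty_le hc hc0 hcC hcost.le hd
    have h4 : ∫ w, L w ∂μ = ∫ p, L (p.1, p.2.1) ∂ρ := by
      rw [← hρμ, integral_map measurable_dropIndex.aemeasurable hL.aestronglyMeasurable]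
    have h5 : dualLinear pL pU (ε + δ) d = dualLinear pL pU ε d + d.α * δ := by
      simp only [dualLinear]; ring
    exact ⟨h1, by linarith⟩
  rw [dualObjective_of_integrable (key 1 one_pos).1, EReal.coe_le_coe_iff]
  refine le_of_forall_pos_le_add fun δ hδ => ?_
  have hα : 0 < d.α + 1 := by linarith [hd.1]
  refine (key (δ / (d.α + 1)) (div_pos hδ hα)).2.trans ?_
  gcongr
  rw [mul_div_assoc', div_le_iff₀ hα, mul_comm]
  exact mul_le_mul_of_nonneg_left (by linarith) hδ.le

/-- Strong duality. Every real number below the dual value is a lower bound for the expected loss of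
a plan that meets all constraints exactly; this plan is obtained by compactness. -/
theorem dualValue_le_worstCase [MeasurableSingletonClass X] (PX : Measure X)
    [IsProbabilityMeasure PX]
    {c : (X × Y) × (X × Y) → ℝ} (hc : Measurable c) (hc0 : ∀ p, 0 ≤ c p)
    {C : ℝ} (hcC : ∀ p, c p ≤ C) {L : X × Y → ℝ} (hL : Measurable L) {M : ℝ}
    (hLM : ∀ w, L w ≤ M) {pL pU : Y → ℝ} (hp : ∀ y, pL y ≤ pU y) {z : Fin N → X × Y} {ε : ℝ}
    (hne : (decisionSet PX pL pU c ε z).Nonempty) :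
    dualValue PX pL pU c ε z L ≤ worstCase PX pL pU c ε z L := by
  refine EReal.ge_of_forall_gt_iff_ge.1 fun t ht => ?_
  obtain ⟨μ, hμ⟩ := hne
  have hM : ∀ (n : ℕ) w, |max (L w) (-n : ℝ)| ≤ |M| + n := fun n w => by
    have h1 := hLM w
    have h2 := le_abs_self M
    have h3 := abs_nonneg M
    have hn : (0 : ℝ) ≤ n := Nat.cast_nonneg n
    exact abs_le.2 ⟨by linarith [le_max_right (L w) (-n : ℝ)],
      max_le (by linarith) (by linarith)⟩
  have hLn : ∀ n : ℕ, Measurable fun w => max (L w) (-n : ℝ) := fun n => hL.max measurable_const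
  -- Plans that are optimal up to `t` for truncated losses and slightly relaxed transport budgets.
  have happrox : ∀ n : ℕ, ∃ ρ : Measure (X × (Y × Fin N)), IsPlan PX pL pU ρ ∧
      ∫ p, c (pairWithSample z p) ∂ρ ≤ ε + 1 / ((n : ℝ) + 1) ∧
      t ≤ ∫ p, max (L (p.1, p.2.1)) (-n : ℝ) ∂ρ := by
    intro n
    by_contra! hcon
    have hpos : (0 : ℝ) < 1 / ((n : ℝ) + 1) := Nat.one_div_pos_of_nat
    have hlt : ((wasserstein c μ (empirical z) : ℝ≥0∞) : EReal) <
        ((ε + 1 / ((n : ℝ) + 1) : ℝ) : EReal) :=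
      hμ.2.2.trans_lt (by exact_mod_cast lt_add_of_pos_right ε hpos)
    obtain ⟨ρ₀, hρ₀, -, hcost₀⟩ := exists_isPlan_of_mem_marginalSet hμ.1 hc hc0 hcC hlt
    obtain ⟨d, hd, hdt⟩ := exists_dual_le_of_forall_lt PX hc hc0 hcC (hLn n) (hM n) hp z
      ⟨ρ₀, hρ₀, hcost₀.le⟩ hcon
    refine ht.not_ge ((iInf₂_le d hd).trans ?_)
    have hmono : ∀ x, dualMax c z L d x ≤ dualMax c z (fun w => max (L w) (-n : ℝ)) d x :=
      fun x => dualMax_le fun j => (sub_le_sub_right (le_max_left _ _) _).trans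
        (le_dualMax (L := fun w => max (L w) (-n : ℝ)) (x, j))
    have hprob := isProbabilityMeasure_of_map_fst hρ₀.map_fst
    have hint : Integrable (dualMax c z (fun w => max (L w) (-n : ℝ)) d) PX :=
      (integral_sub_penalty_le (z := z) (d := d) hc hc0 hcC (hLn n)
        (fun w => (le_abs_self _).trans (hM n w)) hρ₀.map_fst
        (Integrable.of_bound ((hLn n).comp measurable_dropIndex).aestronglyMeasurable _
          (Filter.Eventually.of_forall fun p => hM n _))).1
    calc dualObjective PX pL pU c ε z L d
        ≤ dualObjective PX pL pU c ε z (fun w => max (L w) (-n : ℝ)) d :=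
          add_le_add_right (expect_mono hmono) _
      _ = ((dualLinear pL pU ε d +
            ∫ x, dualMax c z (fun w => max (L w) (-n : ℝ)) d x ∂PX : ℝ) : EReal) :=
          dualObjective_of_integrable hint
      _ ≤ (t : EReal) := by
          rw [EReal.coe_le_coe_iff]
          have h1 : dualLinear pL pU (ε + 1 / ((n : ℝ) + 1)) d =
              dualLinear pL pU ε d + d.α * (1 / ((n : ℝ) + 1)) := by
            simp only [dualLinear]; ring
          have h2 := mul_nonneg hd.1 hpos.le
          linarith
  -- By compactness a single plan is optimal up to `t` for all truncations, with the exact budget.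
  obtain ⟨ρ, hρ, hcost, hloss⟩ : ∃ ρ : Measure (X × (Y × Fin N)), IsPlan PX pL pU ρ ∧
      ∫ p, c (pairWithSample z p) ∂ρ ≤ ε ∧
      ∀ n : ℕ, t ≤ ∫ p, max (L (p.1, p.2.1)) (-n : ℝ) ∂ρ := by
    have hlab : Measurable fun p : X × (Y × Fin N) => p.2.1 := measurable_fst.comp measurable_snd
    let index : Fin N → TestFun (X × (Y × Fin N)) := fun i =>
      TestFun.indicator (measurable_sampleIndex (measurableSet_singleton i))
    let label : Y → TestFun (X × (Y × Fin N)) := fun y =>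
      TestFun.indicator (hlab (measurableSet_singleton y))
    let cost : TestFun (X × (Y × Fin N)) := ⟨fun p => c (pairWithSample z p),
      hc.comp (measurable_pairWithSample z), C, fun p => by
        rw [abs_of_nonneg (hc0 _)]; exact hcC _⟩
    let gain : ℕ → TestFun (X × (Y × Fin N)) := fun n => ⟨fun p => max (L (p.1, p.2.1)) (-n : ℝ),
      (hLn n).comp measurable_dropIndex, _, fun p => hM n _⟩
    have hindex : ∀ (ρ : Measure (X × (Y × Fin N))) i, ∫ p, (index i).toFun p ∂ρ
        = ρ.real ((fun p => p.2.2) ⁻¹' {i}) := fun ρ i => by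
      simp [index, TestFun.indicator, integral_indicator (measurable_sampleIndex
        (measurableSet_singleton i))]
    have hlabel : ∀ (ρ : Measure (X × (Y × Fin N))) y, ∫ p, (label y).toFun p ∂ρ
        = ρ.real ((fun p => p.2.1) ⁻¹' {y}) := fun ρ y => by
      simp [label, TestFun.indicator, integral_indicator (hlab (measurableSet_singleton y))]
    let F : ℕ → Set (TestFun (X × (Y × Fin N)) → ℝ) := fun n =>
      (⋂ i, {v | v (index i) = 1 / (N : ℝ)}) ∩ ((⋂ y, {v | v (label y) ∈ Set.Icc (pL y) (pU y)}) ∩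
        ({v | v cost ≤ ε + 1 / ((n : ℝ) + 1)} ∩ {v | t ≤ v (gain n)}))
    have hF : ∀ n, IsClosed (F n) := fun n =>
      (isClosed_iInter fun i => isClosed_eq (continuous_apply _) continuous_const).inter
        ((isClosed_iInter fun y => isClosed_Icc.preimage (continuous_apply _)).inter
          ((isClosed_le (continuous_apply _) continuous_const).inter
            (isClosed_le continuous_const (continuous_apply _))))
    let K : Set (TestFun (X × (Y × Fin N)) → ℝ) := {v | ∃ ρ : Measure (X × (Y × Fin N)),
      ρ.map Prod.fst = PX ∧ ∀ a, v a = ∫ t, a.toFun t ∂ρ}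
    have hK : IsCompact K := isCompact_integrals_of_marginal PX
    have hanti : ∀ n, K ∩ F (n + 1) ⊆ K ∩ F n := by
      rintro n v ⟨⟨ρ, hρ, hv⟩, h1, h2, h3, h4⟩
      have hprob := isProbabilityMeasure_of_map_fst hρ
      have h3' : v cost ≤ ε + 1 / (((n + 1 : ℕ) : ℝ) + 1) := h3
      have h4' : t ≤ v (gain (n + 1)) := h4
      refine ⟨⟨ρ, hρ, hv⟩, h1, h2, h3'.trans ?_, h4'.trans ?_⟩
      · have h5 : 1 / (((n + 1 : ℕ) : ℝ) + 1) ≤ 1 / ((n : ℝ) + 1) :=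
          Nat.one_div_le_one_div n.le_succ
        linarith
      · rw [hv, hv]
        refine integral_mono ((gain _).integrable ρ) ((gain _).integrable ρ) fun p => ?_
        exact max_le_max le_rfl (neg_le_neg (Nat.cast_le.2 n.le_succ))
    have hnonempty : ∀ n, (K ∩ F n).Nonempty := by
      intro n
      obtain ⟨ρ, hρ, hcost, hloss⟩ := happrox n
      refine ⟨fun a => ∫ p, a.toFun p ∂ρ, ⟨ρ, hρ.map_fst, fun a => rfl⟩, ?_, ?_, hcost, hloss⟩
      · exact Set.mem_iInter.2 fun i => (hindex ρ i).trans (hρ.index i)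
      · refine Set.mem_iInter.2 fun y => ?_
        have := hρ.label y
        rw [← hlabel ρ y] at this
        exact this
    obtain ⟨v, hv⟩ := IsCompact.nonempty_iInter_of_sequence_nonempty_isCompact_isClosed
      (fun n => K ∩ F n) hanti hnonempty (hK.inter_right (hF 0))
      fun n => hK.isClosed.inter (hF n)
    rw [Set.mem_iInter] at hv
    obtain ⟨⟨ρ, hρ, hvρ⟩, h1, h2, -, -⟩ := hv 0
    refine ⟨ρ, ⟨hρ, fun y => ?_, fun i => ?_⟩, ?_, fun n => ?_⟩
    · rw [← hlabel ρ y, ← hvρ]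
      exact Set.mem_iInter.1 h2 y
    · rw [← hindex ρ i, ← hvρ]
      exact Set.mem_iInter.1 h1 i
    · have h3 : ∀ n : ℕ, v cost ≤ ε + 1 / ((n : ℝ) + 1) := fun n => (hv n).2.2.2.1
      have h4 : Filter.Tendsto (fun n : ℕ => ε + 1 / ((n : ℝ) + 1)) Filter.atTop (nhds (ε + 0)) :=
        tendsto_const_nhds.add tendsto_one_div_add_atTop_nhds_zero_nat
      rw [add_zero] at h4
      exact (hvρ cost).symm.trans_le (ge_of_tendsto' h4 h3)
    · exact (hv n).2.2.2.2.trans_eq (hvρ (gain n))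
  have hprob := isProbabilityMeasure_of_map_fst hρ.map_fst
  obtain ⟨hint, htL⟩ := integrable_of_le_integral_truncation
    (φ := fun p : X × (Y × Fin N) => L (p.1, p.2.1))
    (hL.comp measurable_dropIndex) (fun p => hLM _) hloss
  refine le_iSup₂_of_le _ (hρ.map_mem_decisionSet hc hc0 hcC hcost) ?_
  rw [expect_of_integrable ((integrable_map_measure hL.aestronglyMeasurable
    measurable_dropIndex.aemeasurable).2 hint),
    integral_map measurable_dropIndex.aemeasurable hL.aestronglyMeasurable]
  exact_mod_cast htL

end StrongDuality


/-! ### A priori bounds for multipliers -/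

section DualBounds

/-- The difference of two dual vectors. -/
def DualVar.diff {Y : Type*} {N : ℕ} (d d' : DualVar Y N) : DualVar Y N :=
  ⟨d.α - d'.α, fun i => d.β i - d'.β i, fun y => d.lamU y - d'.lamU y,
    fun y => d.lamL y - d'.lamL y⟩

/-- The dual vector with transport multiplier `α`, sample multipliers `β` and net label
multipliers `lam`, the latter split into positive and negative parts. -/
def DualVar.ofNet {Y : Type*} {N : ℕ} (q : ℝ × (Fin N → ℝ) × (Y → ℝ)) : DualVar Y N :=
  ⟨q.1, q.2.1, fun y => max (q.2.2 y) 0, fun y => max (-q.2.2 y) 0⟩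

lemma DualVar.ofNet_lamU_sub_lamL {Y : Type*} {N : ℕ} (q : ℝ × (Fin N → ℝ) × (Y → ℝ)) (y : Y) :
    (DualVar.ofNet q).lamU y - (DualVar.ofNet q).lamL y = q.2.2 y :=
  max_zero_sub_max_neg_zero_eq_self _

lemma DualVar.feasible_ofNet {Y : Type*} {N : ℕ} {q : ℝ × (Fin N → ℝ) × (Y → ℝ)} (hq : 0 ≤ q.1) :
    (DualVar.ofNet q).Feasible :=
  ⟨hq, fun _ => le_max_right _ _, fun _ => le_max_right _ _⟩

lemma exists_pos_le_of_finite {ι : Type*} [Finite ι] (f : ι → ℝ) :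
    ∃ s > 0, ∀ i, 0 < f i → s ≤ f i := by
  classical
  have := Fintype.ofFinite ι
  by_cases h : (Finset.univ.filter fun i => 0 < f i).Nonempty
  · obtain ⟨i, hi, hmin⟩ := Finset.exists_min_image _ f h
    exact ⟨f i, (Finset.mem_filter.1 hi).2, fun j hj =>
      hmin j (Finset.mem_filter.2 ⟨Finset.mem_univ j, hj⟩)⟩
  · refine ⟨1, one_pos, fun i hi => ?_⟩
    exact absurd ⟨i, Finset.mem_filter.2 ⟨Finset.mem_univ i, hi⟩⟩ h

/-- A priori bounds for normalized multipliers. The bound `R` stands for the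
dual objective at `(α, β, lam)` plus error terms. The first inequality `hslater` comes from the strictly feasible
plan with label probabilities `p` and slack `s`, the inequalities `hdirac` from the plans that are
concentrated on one label and one sample point. The `β i` are normalized to have minimum `0`, and
`lam` at the anchor label `k`. -/
lemma multiplier_bounds {Y : Type*} [Fintype Y] {N : ℕ} [NeZero N] {p pL pU lam : Y → ℝ}
    {β : Fin N → ℝ} {α s C O R : ℝ} {k : Y} (hs : 0 < s) (hC : 0 ≤ C) (hO : 0 ≤ O) (hα : 0 ≤ α)
    (hsN : s ≤ 1 / (N : ℝ)) (hp1 : ∑ y, p y = 1) (hp : ∀ y, p y ∈ Set.Icc (pL y) (pU y))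
    (hpos : ∀ y, pU y ≠ 0 → s ≤ p y) (hzero : ∀ y, pU y = 0 → p y = 0)
    (hslack : ∀ y, pL y < pU y → s ≤ pU y - p y ∧ s ≤ p y - pL y) (hk : pU k ≠ 0)
    (hanchor : pL k < pU k ∨ lam k = 0) (hβ : ∀ i, 0 ≤ β i) (hβ0 : ∃ i, β i = 0)
    (hlam : ∀ y, pU y = 0 → |lam y| ≤ O + α * C + |lam k|)
    (hslater : α * s + ∑ y, (max (lam y) 0 * (pU y - p y) + max (-lam y) 0 * (p y - pL y)) ≤ R)
    (hdirac : ∀ i y, ((1 / (N : ℝ)) * ∑ i, β i - β i) + (∑ y, p y * lam y - lam y) - α * C ≤ R) :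
    α ≤ R / s ∧ (∀ i, β i ≤ R * ((1 + C / s) / s)) ∧
      ∀ y, |lam y| ≤ O + R * ((1 + C / s) / s + (1 + C) / s) := by
  classical
  have hterm : ∀ y, 0 ≤ max (lam y) 0 * (pU y - p y) + max (-lam y) 0 * (p y - pL y) := fun y =>
    add_nonneg (mul_nonneg (le_max_right _ _) (sub_nonneg.2 (hp y).2))
      (mul_nonneg (le_max_right _ _) (sub_nonneg.2 (hp y).1))
  have hsum := Finset.sum_nonneg fun y (_ : y ∈ Finset.univ) => hterm y
  have hαs : 0 ≤ α * s := mul_nonneg hα hs.le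
  have hR : 0 ≤ R := by linarith
  have hαR : α ≤ R / s := by rw [le_div_iff₀ hs]; linarith
  have hkR : |lam k| ≤ R / s := by
    rcases hanchor with h | h
    · obtain ⟨h1, h2⟩ := hslack k h
      have h3 := Finset.single_le_sum (fun y (_ : y ∈ Finset.univ) => hterm y) (Finset.mem_univ k)
      rw [le_div_iff₀ hs]
      have h4 : max (lam k) 0 * s ≤ max (lam k) 0 * (pU k - p k) :=
        mul_le_mul_of_nonneg_left h1 (le_max_right _ _)
      have h5 : max (-lam k) 0 * s ≤ max (-lam k) 0 * (p k - pL k) :=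
        mul_le_mul_of_nonneg_left h2 (le_max_right _ _)
      have h6 : |lam k| = max (lam k) 0 + max (-lam k) 0 := by
        rcases le_total 0 (lam k) with h | h
        · rw [abs_of_nonneg h, max_eq_left h, max_eq_right (neg_nonpos.2 h), add_zero]
        · rw [abs_of_nonpos h, max_eq_right h, max_eq_left (neg_nonneg.2 h), zero_add]
      rw [h6, add_mul]
      linarith
    · rw [h, abs_zero]
      exact div_nonneg hR hs.le
  have hαC : α * C ≤ R * (C / s) := by
    calc α * C ≤ R / s * C := mul_le_mul_of_nonneg_right hαR hC
      _ = R * (C / s) := by ring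
  -- The smallest net multiplier among the labels of positive probability.
  obtain ⟨y₀, hy₀, hmin⟩ := Finset.exists_min_image (Finset.univ.filter fun y => pU y ≠ 0) lam
    ⟨k, Finset.mem_filter.2 ⟨Finset.mem_univ k, hk⟩⟩
  have hmin' : ∀ y, pU y ≠ 0 → lam y₀ ≤ lam y := fun y hy =>
    hmin y (Finset.mem_filter.2 ⟨Finset.mem_univ y, hy⟩)
  obtain ⟨i₀, hi₀⟩ := hβ0
  have hT := hdirac i₀ y₀
  have hlamsum : ∑ y, p y * lam y - lam y₀ = ∑ y, p y * (lam y - lam y₀) := by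
    simp only [mul_sub, Finset.sum_sub_distrib, ← Finset.sum_mul, hp1, one_mul]
  have hpterm : ∀ y, 0 ≤ p y * (lam y - lam y₀) := by
    intro y
    by_cases hy : pU y = 0
    · rw [hzero y hy, zero_mul]
    · exact mul_nonneg (hs.le.trans (hpos y hy)) (sub_nonneg.2 (hmin' y hy))
  have hpsum := Finset.sum_nonneg fun y (_ : y ∈ Finset.univ) => hpterm y
  have hβsum := Finset.sum_nonneg fun i (_ : i ∈ Finset.univ) => hβ i
  have hNpos : (0 : ℝ) ≤ 1 / (N : ℝ) := by positivity
  have hβmean := mul_nonneg hNpos hβsum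
  rw [hi₀, hlamsum, sub_zero] at hT
  have hQ : R * ((1 + C / s) / s) = (R + R * (C / s)) / s := by ring
  have hβR : ∀ i, β i ≤ R * ((1 + C / s) / s) := by
    intro i
    rw [hQ, le_div_iff₀ hs]
    have h1 := Finset.single_le_sum (fun i (_ : i ∈ Finset.univ) => hβ i) (Finset.mem_univ i)
    have h2 : β i * s ≤ 1 / (N : ℝ) * ∑ i, β i := by
      rw [mul_comm]
      exact mul_le_mul hsN h1 (hβ i) hNpos
    linarith
  have hspread : ∀ y, pU y ≠ 0 → lam y - lam y₀ ≤ R * ((1 + C / s) / s) := by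
    intro y hy
    rw [hQ, le_div_iff₀ hs]
    have h1 := Finset.single_le_sum (fun y (_ : y ∈ Finset.univ) => hpterm y) (Finset.mem_univ y)
    have h2 : (lam y - lam y₀) * s ≤ p y * (lam y - lam y₀) := by
      rw [mul_comm]
      exact mul_le_mul_of_nonneg_right (hpos y hy) (sub_nonneg.2 (hmin' y hy))
    linarith
  refine ⟨hαR, hβR, fun y => ?_⟩
  have hsplit : R * ((1 + C / s) / s + (1 + C) / s) =
      R * ((1 + C / s) / s) + (R / s + R * (C / s)) := by ring
  have hRC : 0 ≤ R * (C / s) := mul_nonneg hR (div_nonneg hC hs.le)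
  have hRs : 0 ≤ R / s := div_nonneg hR hs.le
  have hRQ : 0 ≤ R * ((1 + C / s) / s) := by rw [hQ]; exact div_nonneg (by linarith) hs.le
  rw [hsplit]
  by_cases hy : pU y = 0
  · have := hlam y hy
    linarith
  · have h1 := hspread y hy
    have h2 := hspread k hk
    have h3 := hmin' y hy
    have h4 := hmin' k hk
    have h5 := abs_le.1 hkR
    refine abs_le.2 ⟨by linarith [h5.1], by linarith [h5.2]⟩

end DualBounds

/-! ### Lower bounds for the expected dual maximum -/

section Attainment

variable {X Y : Type*} [Fintype Y] {N : ℕ} {C : ℝ}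

lemma DualVar.size_nonneg (d : DualVar Y N) (hC : 0 ≤ C) : 0 ≤ d.size C :=
  add_nonneg (add_nonneg (mul_nonneg (abs_nonneg _) hC) (Finset.sum_nonneg fun _ _ => abs_nonneg _))
    (Finset.sum_nonneg fun _ _ => abs_nonneg _)

variable [Nonempty Y] [NeZero N] {c : (X × Y) × (X × Y) → ℝ} {L : X × Y → ℝ} {z : Fin N → X × Y}

lemma dualMax_le_add_size (hc0 : ∀ p, 0 ≤ c p) (hcC : ∀ p, c p ≤ C) (d d' : DualVar Y N) (x : X) :
    dualMax c z L d x ≤ dualMax c z L d' x + (d'.diff d).size C := by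
  refine dualMax_le fun j => ?_
  have h1 := le_dualMax (c := c) (z := z) (L := L) (d := d') (x, j)
  have h2 := (abs_le.1 (abs_penalty_le (z := z) (d := d'.diff d) hc0 hcC (x, j))).2
  have h3 : penalty c z (d'.diff d) (x, j) = penalty c z d' (x, j) - penalty c z d (x, j) := by
    simp only [penalty, DualVar.diff]; ring
  simp only at h1
  linarith

variable [MeasurableSpace X] [MeasurableSpace Y] [MeasurableSingletonClass Y]
  {PX : Measure X} [IsProbabilityMeasure PX]

lemma integrable_dualMax (hc : Measurable c) (hc0 : ∀ p, 0 ≤ c p) (hcC : ∀ p, c p ≤ C)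
    (hL : Measurable L) {d' : DualVar Y N} (h : Integrable (dualMax c z L d') PX)
    (d : DualVar Y N) : Integrable (dualMax c z L d) PX := by
  refine (h.norm.add (integrable_const ((d'.diff d).size C + (d.diff d').size C))).mono'
    (measurable_dualMax hc hL).aestronglyMeasurable (Filter.Eventually.of_forall fun x => ?_)
  have h1 := dualMax_le_add_size (z := z) (L := L) hc0 hcC d d' x
  have h2 := dualMax_le_add_size (z := z) (L := L) hc0 hcC d' d x
  have hC : 0 ≤ C := (hc0 (pairWithSample z (x, Classical.arbitrary _))).trans (hcC _)
  have h3 := (d'.diff d).size_nonneg hC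
  have h4 := (d.diff d').size_nonneg hC
  have h5 := neg_abs_le (dualMax c z L d' x)
  have h6 := le_abs_self (dualMax c z L d' x)
  simp only [Pi.add_apply, Real.norm_eq_abs]
  exact abs_le.2 ⟨by linarith, by linarith⟩

/-- A lower bound for the expected dual maximum by an arbitrary plan `ρ`, without the assumption
that the loss is integrable under `ρ`: away from a set of small probability the loss is bounded
below, and on that set the best label is used instead. -/
lemma exists_neg_penalty_le_integral_dualMax (hc : Measurable c) (hc0 : ∀ p, 0 ≤ c p)
    (hcC : ∀ p, c p ≤ C) (hL : Measurable L)
    {d₀ : DualVar Y N} (h₀ : Integrable (dualMax c z L d₀) PX) {τ : ℝ} (hτ : 0 < τ) :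
    ∃ K, ∀ (d : DualVar Y N) (ρ : Measure (X × (Y × Fin N))), ρ.map Prod.fst = PX →
      -∫ p, penalty c z d p ∂ρ - K - τ * d.size C ≤ ∫ x, dualMax c z L d x ∂PX := by
  let O : DualVar Y N := ⟨0, 0, 0, 0⟩
  have hO := integrable_dualMax hc hc0 hcC hL h₀ O
  obtain ⟨x₀⟩ : Nonempty X := PX.nonempty_of_neZero
  have hC : 0 ≤ C := (hc0 (pairWithSample z (x₀, Classical.arbitrary _))).trans (hcC _)
  let A : ℕ → Set X := fun n => {x | ∃ y, L (x, y) < -(n : ℝ)}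
  have hA : ∀ n, MeasurableSet (A n) := fun n => by
    have : A n = ⋃ y, {x | L (x, y) < -(n : ℝ)} := by ext x; simp [A]
    rw [this]
    exact MeasurableSet.iUnion fun y =>
      measurableSet_lt (hL.comp (measurable_id.prodMk measurable_const)) measurable_const
  have hanti : Antitone A := fun m n hmn x ⟨y, hy⟩ =>
    ⟨y, hy.trans_le (neg_le_neg (Nat.cast_le.2 hmn))⟩
  have hinter : ⋂ n, A n = ∅ := by
    refine Set.eq_empty_of_forall_notMem fun x hx => ?_
    rw [Set.mem_iInter] at hx
    obtain ⟨b, hb⟩ := (Set.finite_range fun y => -L (x, y)).bddAbove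
    obtain ⟨n, hn⟩ := exists_nat_ge b
    obtain ⟨y, hy⟩ := hx n
    have := hb ⟨y, rfl⟩
    simp only at this
    linarith
  have hlim := tendsto_measure_iInter_atTop (μ := PX) (fun n => (hA n).nullMeasurableSet) hanti
    ⟨0, measure_ne_top _ _⟩
  rw [hinter, measure_empty] at hlim
  obtain ⟨n, hn⟩ := (hlim.eventually_lt_const (u := ENNReal.ofReal (τ / 2))
    (ENNReal.ofReal_pos.2 (half_pos hτ))).exists
  have hn' : PX.real (A n) ≤ τ / 2 :=
    ENNReal.toReal_le_of_le_ofReal (half_pos hτ).le hn.le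
  refine ⟨n + ∫ x, |dualMax c z L O x| ∂PX, fun d ρ hρ => ?_⟩
  have hprob := isProbabilityMeasure_of_map_fst hρ
  have hpen : Integrable (penalty c z d) ρ :=
    Integrable.of_bound (measurable_penalty hc).aestronglyMeasurable (d.size C)
      (Filter.Eventually.of_forall fun p => abs_penalty_le hc0 hcC p)
  have hD := integrable_dualMax hc hc0 hcC hL h₀ d
  have hlow : Integrable (fun x => -(n : ℝ) - |dualMax c z L O x|
      - (A n).indicator (fun _ => 2 * d.size C) x) PX :=
    ((integrable_const _).sub hO.abs).sub ((integrable_const _).indicator (hA n))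
  have hcomp : ∀ {f : X → ℝ}, Integrable f PX →
      Integrable (fun p : X × (Y × Fin N) => f p.1) ρ ∧ ∫ p, f p.1 ∂ρ = ∫ x, f x ∂PX := by
    intro f hf
    rw [← hρ] at hf ⊢
    exact ⟨hf.comp_measurable measurable_fst,
      (integral_map measurable_fst.aemeasurable hf.aestronglyMeasurable).symm⟩
  have hmain : ∫ p, (-(n : ℝ) - |dualMax c z L O p.1|
      - (A n).indicator (fun _ => 2 * d.size C) p.1) ∂ρ ≤
      ∫ p, (dualMax c z L d p.1 + penalty c z d p) ∂ρ := by
    refine integral_mono (hcomp hlow).1 ((hcomp hD).1.add hpen) fun p => ?_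
    have h1 := abs_le.1 (abs_penalty_le (z := z) (d := d) hc0 hcC p)
    have h2 : 0 ≤ |dualMax c z L O p.1| := abs_nonneg _
    have hn0 : (0 : ℝ) ≤ n := Nat.cast_nonneg n
    by_cases hx : p.1 ∈ A n
    · have h3 := dualMax_le_add_size (z := z) (L := L) hc0 hcC O d p.1
      have h4 : (d.diff O).size C = d.size C := by simp [DualVar.diff, DualVar.size, O]
      rw [h4] at h3
      have h5 := neg_abs_le (dualMax c z L O p.1)
      simp only [Set.indicator_of_mem hx]
      linarith [h1.1]
    · have h3 : -(n : ℝ) ≤ L (p.1, p.2.1) := not_lt.1 fun h => hx ⟨p.2.1, h⟩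
      have h4 := le_dualMax (c := c) (z := z) (L := L) (d := d) p
      simp only [Set.indicator_of_notMem hx]
      linarith
  rw [(hcomp hlow).2, integral_add (hcomp hD).1 hpen, (hcomp hD).2,
    integral_sub (f := fun x => -(n : ℝ) - |dualMax c z L O x|)
      ((integrable_const _).sub hO.abs) ((integrable_const _).indicator (hA n)),
    integral_sub (integrable_const _) hO.abs, integral_indicator (hA n), setIntegral_const] at hmain
  simp only [integral_const, probReal_univ, smul_eq_mul, one_mul] at hmain
  have h1 : PX.real (A n) * (2 * d.size C) ≤ τ * d.size C := by
    have := mul_le_mul_of_nonneg_right hn' (mul_nonneg zero_le_two (d.size_nonneg hC))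
    linarith
  linarith

end Attainment


/-! ### Normalization and continuity of the dual objective -/

section Normalization

variable {X Y : Type*} [MeasurableSpace X] [MeasurableSpace Y] [Fintype Y]
  [MeasurableSingletonClass Y] [Nonempty Y] {N : ℕ} [NeZero N]
  {c : (X × Y) × (X × Y) → ℝ} {C : ℝ} {L : X × Y → ℝ} {z : Fin N → X × Y}
  {PX : Measure X} [IsProbabilityMeasure PX]

/-- The dual objective is invariant under the shift of all `β i`, and, if all label constraints are
equalities, under the shift of all label multipliers. It does not increase if the multipliers of a
label are replaced by the positive and negative parts of their difference, or if a label that must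
have probability `0` gets a large multiplier. -/
lemma exists_normalized_multipliers (hc : Measurable c) (hc0 : ∀ p, 0 ≤ c p)
    (hcC : ∀ p, c p ≤ C) (hL : Measurable L) {d₀ : DualVar Y N}
    (h₀ : Integrable (dualMax c z L d₀) PX) {p pL pU : Y → ℝ} (hpL : ∀ y, 0 ≤ pL y)
    (hpLU : ∀ y, pL y ≤ pU y) (hp : ∀ y, p y ∈ Set.Icc (pL y) (pU y)) (hp1 : ∑ y, p y = 1)
    {k : Y} (hk : pU k ≠ 0) (hanchor : pL k < pU k ∨ ∀ y, pL y = pU y) {O : ℝ} (hO : 0 ≤ O)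
    (hLO : ∀ y, pU y = 0 → ∀ x, L (x, y) ≤ L (x, k) + O) (ε : ℝ) {d : DualVar Y N}
    (hd : d.Feasible) :
    ∃ q : ℝ × (Fin N → ℝ) × (Y → ℝ), 0 ≤ q.1 ∧ (∀ i, 0 ≤ q.2.1 i) ∧ (∃ i, q.2.1 i = 0) ∧
      (pL k < pU k ∨ q.2.2 k = 0) ∧ (∀ y, pU y = 0 → |q.2.2 y| ≤ O + q.1 * C + |q.2.2 k|) ∧
      dualLinear pL pU ε (DualVar.ofNet q) + ∫ x, dualMax c z L (DualVar.ofNet q) x ∂PX ≤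
        dualLinear pL pU ε d + ∫ x, dualMax c z L d x ∂PX := by
  classical
  obtain ⟨i₀, -, hi₀⟩ := Finset.exists_min_image Finset.univ d.β Finset.univ_nonempty
  obtain ⟨x₀⟩ : Nonempty X := PX.nonempty_of_neZero
  have hC : 0 ≤ C := (hc0 (pairWithSample z (x₀, Classical.arbitrary _))).trans (hcC _)
  have hαC : 0 ≤ d.α * C := mul_nonneg hd.1 hC
  let net : Y → ℝ := fun y => d.lamU y - d.lamL y
  let r : ℝ := if pL k < pU k then 0 else net k
  let b : ℝ := d.β i₀
  let lam : Y → ℝ := fun y => if pU y = 0 then O + d.α * C + (net k - r) else net y - r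
  let q : ℝ × (Fin N → ℝ) × (Y → ℝ) := (d.α, fun i => d.β i - b, lam)
  have hlamk : lam k = net k - r := if_neg hk
  refine ⟨q, hd.1, fun i => sub_nonneg.2 (hi₀ i (Finset.mem_univ i)), ⟨i₀, sub_self _⟩, ?_, ?_, ?_⟩
  · by_cases h : pL k < pU k
    · exact Or.inl h
    · refine Or.inr ?_
      change lam k = 0
      rw [hlamk]
      simp [r, h]
  · intro y hy
    change |lam y| ≤ O + d.α * C + |lam k|
    rw [hlamk]
    simp only [lam, hy, if_true]
    refine (abs_add_le _ _).trans_eq ?_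
    rw [abs_of_nonneg (add_nonneg hO hαC)]
  · have hmax : ∀ x, dualMax c z L (DualVar.ofNet q) x ≤ dualMax c z L d x + (b + r) := by
      intro x
      refine dualMax_le fun j => ?_
      have hpen : penalty c z (DualVar.ofNet q) (x, j) =
          d.α * c (pairWithSample z (x, j)) + (d.β j.2 - b) + lam j.1 := by
        simp only [penalty, DualVar.ofNet_lamU_sub_lamL]
        rfl
      rw [hpen]
      by_cases hy : pU j.1 = 0
      · have h1 := le_dualMax (c := c) (z := z) (L := L) (d := d) (x, (k, j.2))
        have h2 : lam j.1 = O + d.α * C + (net k - r) := if_pos hy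
        have h3 := hLO j.1 hy x
        have h4 := mul_le_mul_of_nonneg_left (hcC (pairWithSample z (x, (k, j.2)))) hd.1
        have h5 := mul_nonneg hd.1 (hc0 (pairWithSample z (x, j)))
        simp only [penalty] at h1
        simp only [net] at h2
        rw [h2]
        linarith
      · have h1 := le_dualMax (c := c) (z := z) (L := L) (d := d) (x, j)
        have h2 : lam j.1 = net j.1 - r := if_neg hy
        simp only [penalty] at h1
        simp only [net] at h2
        rw [h2]
        linarith
    have hint := integrable_dualMax hc hc0 hcC hL h₀ d
    have hint' := integrable_dualMax hc hc0 hcC hL h₀ (DualVar.ofNet q)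
    have h1 : ∫ x, dualMax c z L (DualVar.ofNet q) x ∂PX ≤
        ∫ x, dualMax c z L d x ∂PX + (b + r) := by
      refine (integral_mono hint' (hint.add (integrable_const (b + r))) hmax).trans_eq ?_
      rw [integral_add' hint (integrable_const _)]
      simp
    have hN : (N : ℝ) ≠ 0 := Nat.cast_ne_zero.2 (NeZero.ne N)
    have h2 : (1 / (N : ℝ)) * ∑ i, (d.β i - b) = (1 / (N : ℝ)) * ∑ i, d.β i - b := by
      rw [Finset.sum_sub_distrib, mul_sub]
      simp [hN]
    have hterm : ∀ y, max (lam y) 0 * pU y - max (-lam y) 0 * pL y + r * p y ≤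
        d.lamU y * pU y - d.lamL y * pL y := by
      intro y
      by_cases hy : pU y = 0
      · have hL0 : pL y = 0 := le_antisymm (hy ▸ hpLU y) (hpL y)
        have hp0 : p y = 0 := le_antisymm (hy ▸ (hp y).2) (hL0 ▸ (hp y).1)
        simp [hy, hL0, hp0]
      · have hlamy : lam y = net y - r := if_neg hy
        by_cases hkk : pL k < pU k
        · have hr : r = 0 := if_pos hkk
          rw [hlamy, hr, sub_zero, zero_mul, add_zero]
          have h3 : max (net y) 0 - max (-net y) 0 = d.lamU y - d.lamL y :=
            max_zero_sub_max_neg_zero_eq_self _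
          have h4 : max (net y) 0 ≤ d.lamU y :=
            max_le (by simp only [net]; linarith [hd.2.2 y]) (hd.2.1 y)
          have h5 := mul_nonneg (sub_nonneg.2 h4) (sub_nonneg.2 (hpLU y))
          have h6 : max (-net y) 0 = max (net y) 0 - (d.lamU y - d.lamL y) := by linarith
          rw [h6]
          linarith
        · have heq := hanchor.resolve_left hkk
          have hpy : p y = pU y := le_antisymm (hp y).2 (heq y ▸ (hp y).1)
          have h3 : max (lam y) 0 - max (-lam y) 0 = lam y := max_zero_sub_max_neg_zero_eq_self _
          rw [heq y, hpy, ← sub_mul, h3, hlamy]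
          simp only [net]
          exact le_of_eq (by ring)
    have hsum := Finset.sum_le_sum fun y (_ : y ∈ Finset.univ) => hterm y
    rw [Finset.sum_add_distrib, ← Finset.mul_sum, hp1, mul_one] at hsum
    have h3 : dualLinear pL pU ε (DualVar.ofNet q) = d.α * ε + (1 / (N : ℝ)) * ∑ i, (d.β i - b)
        + ∑ y, (max (lam y) 0 * pU y - max (-lam y) 0 * pL y) := rfl
    rw [h3, h2]
    simp only [dualLinear]
    linarith

/-- The dual objective is continuous in the multipliers, because the penalty is Lipschitz in
them, uniformly on `X`. -/
lemma continuous_dualObjective_ofNet (hc : Measurable c) (hc0 : ∀ p, 0 ≤ c p)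
    (hcC : ∀ p, c p ≤ C) (hL : Measurable L) {d₀ : DualVar Y N}
    (h₀ : Integrable (dualMax c z L d₀) PX) (pL pU : Y → ℝ) (ε : ℝ) :
    Continuous fun q : ℝ × (Fin N → ℝ) × (Y → ℝ) =>
      dualLinear pL pU ε (DualVar.ofNet q) + ∫ x, dualMax c z L (DualVar.ofNet q) x ∂PX := by
  refine Continuous.add ?_ ?_
  · simp only [dualLinear, DualVar.ofNet]
    fun_prop
  · have hint := fun d => integrable_dualMax hc hc0 hcC hL h₀ d
    have hle : ∀ d d' : DualVar Y N, ∫ x, dualMax c z L d x ∂PX ≤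
        ∫ x, dualMax c z L d' x ∂PX + (d'.diff d).size C := by
      intro d d'
      refine (integral_mono (hint d) ((hint d').add (integrable_const _))
        (dualMax_le_add_size hc0 hcC d d')).trans_eq ?_
      rw [integral_add' (hint d') (integrable_const _)]
      simp
    have hcont : ∀ q₀ : ℝ × (Fin N → ℝ) × (Y → ℝ), Continuous
        fun q : ℝ × (Fin N → ℝ) × (Y → ℝ) =>
        |q₀.1 - q.1| * C + ∑ i, |q₀.2.1 i - q.2.1 i| + ∑ y, |q₀.2.2 y - q.2.2 y| := fun q₀ => by
      fun_prop
    have hsize : ∀ q q' : ℝ × (Fin N → ℝ) × (Y → ℝ),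
        ((DualVar.ofNet q).diff (DualVar.ofNet q')).size C =
          |q.1 - q'.1| * C + ∑ i, |q.2.1 i - q'.2.1 i| + ∑ y, |q.2.2 y - q'.2.2 y| := by
      intro q q'
      have h1 : ∀ y, ((DualVar.ofNet q).diff (DualVar.ofNet q')).lamU y
          - ((DualVar.ofNet q).diff (DualVar.ofNet q')).lamL y = q.2.2 y - q'.2.2 y := by
        intro y
        rw [← DualVar.ofNet_lamU_sub_lamL q y, ← DualVar.ofNet_lamU_sub_lamL q' y]
        simp only [DualVar.diff]; ring
      simp only [DualVar.size, h1]
      rfl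
    refine continuous_iff_continuousAt.2 fun q₀ => ?_
    refine tendsto_iff_dist_tendsto_zero.2 ?_
    have hlim := (hcont q₀).tendsto q₀
    simp only [sub_self, abs_zero, zero_mul, Finset.sum_const_zero, add_zero] at hlim
    refine squeeze_zero (fun _ => dist_nonneg) (fun q => ?_) hlim
    have h1 := hle (DualVar.ofNet q) (DualVar.ofNet q₀)
    have h2 := hle (DualVar.ofNet q₀) (DualVar.ofNet q)
    rw [hsize] at h1 h2
    simp only [abs_sub_comm (q.1), abs_sub_comm (q.2.1 _), abs_sub_comm (q.2.2 _)] at h2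
    rw [Real.dist_eq]
    exact abs_le.2 ⟨by linarith, by linarith⟩

end Normalization


/-! ### Attainment of the dual value -/

section Attainment

variable {X Y : Type*} [MeasurableSpace X] [MeasurableSpace Y] [Fintype Y]
  [MeasurableSingletonClass X] [MeasurableSingletonClass Y] [Nonempty Y] {N : ℕ} [NeZero N]
  {c : (X × Y) × (X × Y) → ℝ} {C : ℝ} {L : X × Y → ℝ} {M : ℝ} {z : Fin N → X × Y}
  {PX : Measure X} [IsProbabilityMeasure PX]

/-- The dual value is attained: outside a compact box of normalized multipliers the dual objective
is larger than at `0`. -/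
theorem exists_dualObjective_eq_dualValue (hc : Measurable c) (hc0 : ∀ p, 0 ≤ c p)
    (hcC : ∀ p, c p ≤ C) (hL : Measurable L) (hLM : ∀ w, L w ≤ M) {pL pU : Y → ℝ}
    (hpL : ∀ y, 0 ≤ pL y) (hpLU : ∀ y, pL y ≤ pU y) {ε : ℝ}
    (hne : (relintDecisionSet PX pL pU c ε z).Nonempty)
    (hbdd : (∀ y, 0 < pU y) ∨ BddBelow (Set.range L)) :
    ∃ d : DualVar Y N, d.Feasible ∧
      dualObjective PX pL pU c ε z L d = dualValue PX pL pU c ε z L := by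
  classical
  let Z : DualVar Y N := ⟨0, 0, 0, 0⟩
  by_cases h₀ : Integrable (dualMax c z L Z) PX
  swap
  -- The dual objective is identically `⊥`, so that any feasible dual vector is optimal.
  · have hZ : Z.Feasible := ⟨le_rfl, fun y => le_rfl, fun y => le_rfl⟩
    have hbot : dualObjective PX pL pU c ε z L Z = ⊥ := by
      rw [dualObjective, expect_eq_bot (C := M) (measurable_dualMax hc hL) (fun x => ?_) h₀,
        EReal.add_bot]
      refine dualMax_le fun j => ?_
      simpa [penalty, Z] using hLM (x, j.1)
    refine ⟨Z, hZ, le_antisymm (hbot.trans_le bot_le) (iInf₂_le Z hZ)⟩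
  obtain ⟨μ, hμ, hWε, hstrict⟩ := hne
  obtain ⟨ρ₀, hρ₀, hρμ, hcost⟩ := exists_isPlan_of_mem_marginalSet hμ.1 hc hc0 hcC hWε
  have hprob₀ := isProbabilityMeasure_of_map_fst hρ₀.map_fst
  have hlab : Measurable fun p : X × (Y × Fin N) => p.2.1 := measurable_fst.comp measurable_snd
  let p : Y → ℝ := fun y => ρ₀.real ((fun p => p.2.1) ⁻¹' {y})
  have hp : ∀ y, p y ∈ Set.Icc (pL y) (pU y) := hρ₀.label
  have hpstrict : ∀ y, pL y < pU y → p y ∈ Set.Ioo (pL y) (pU y) := fun y hy => by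
    have := hstrict y hy
    rwa [← hρμ, labelProb_map] at this
  have hp1 : ∑ y, p y = 1 := by
    have := integral_comp_fintype (ρ := ρ₀) hlab fun _ : Y => (1 : ℝ)
    simpa using this.symm
  have hppos : ∀ y, pU y ≠ 0 → 0 < p y := by
    intro y hy
    rcases (hpLU y).lt_or_eq with h | h
    · exact (hpL y).trans_lt (hpstrict y h).1
    · have h1 : 0 ≤ pL y := hpL y
      have h2 : 0 < pL y := lt_of_le_of_ne h1 fun h3 => hy (by rw [← h, ← h3])
      exact h2.trans_le (hp y).1
  have hpzero : ∀ y, pU y = 0 → p y = 0 := fun y hy =>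
    le_antisymm (hy ▸ (hp y).2) ((hpL y).trans (hp y).1)
  obtain ⟨k, hk, hanchor⟩ : ∃ k, pU k ≠ 0 ∧ (pL k < pU k ∨ ∀ y, pL y = pU y) := by
    by_cases h : ∃ y, pL y < pU y
    · obtain ⟨y, hy⟩ := h
      exact ⟨y, ((hpL y).trans_lt hy).ne', Or.inl hy⟩
    · push Not at h
      obtain ⟨y, -, hy⟩ := Finset.exists_ne_zero_of_sum_ne_zero (hp1.trans_ne one_ne_zero)
      exact ⟨y, fun hy' => hy (hpzero y hy'), Or.inr fun y => (hpLU y).antisymm (h y)⟩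
  obtain ⟨O, hO, hLO⟩ : ∃ O : ℝ, 0 ≤ O ∧ ∀ y, pU y = 0 → ∀ x, L (x, y) ≤ L (x, k) + O := by
    rcases hbdd with h | ⟨b, hb⟩
    · exact ⟨0, le_rfl, fun y hy => absurd hy (h y).ne'⟩
    · refine ⟨|M - b|, abs_nonneg _, fun y _ x => ?_⟩
      have h1 := hb ⟨(x, k), rfl⟩
      linarith [hLM (x, y), le_abs_self (M - b)]
  obtain ⟨x₀⟩ : Nonempty X := PX.nonempty_of_neZero
  have hC : 0 ≤ C := (hc0 (pairWithSample z (x₀, Classical.arbitrary _))).trans (hcC _)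
  -- The slack of the strictly feasible plan.
  let cost₀ := ∫ p, c (pairWithSample z p) ∂ρ₀
  have hcost₀ : cost₀ < ε := hcost
  have hε : 0 ≤ ε := (integral_nonneg fun p => hc0 (pairWithSample z p)).trans hcost₀.le
  have hN : 0 < 1 / (N : ℝ) := one_div_pos.2 (Nat.cast_pos.2 (NeZero.pos N))
  obtain ⟨s, hs, hsε, hsN, hsp, hslack⟩ : ∃ s : ℝ, 0 < s ∧ s ≤ ε - cost₀ ∧ s ≤ 1 / (N : ℝ) ∧
      (∀ y, pU y ≠ 0 → s ≤ p y) ∧ ∀ y, pL y < pU y → s ≤ pU y - p y ∧ s ≤ p y - pL y := by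
    obtain ⟨s₁, h1, h1'⟩ := exists_pos_le_of_finite p
    obtain ⟨s₂, h2, h2'⟩ := exists_pos_le_of_finite fun y => pU y - p y
    obtain ⟨s₃, h3, h3'⟩ := exists_pos_le_of_finite fun y => p y - pL y
    refine ⟨min (min (ε - cost₀) (1 / (N : ℝ))) (min s₁ (min s₂ s₃)), ?_, ?_, ?_, ?_, ?_⟩
    · simp only [lt_min_iff]
      exact ⟨⟨sub_pos.2 hcost₀, hN⟩, h1, h2, h3⟩
    · exact (min_le_left _ _).trans (min_le_left _ _)
    · exact (min_le_left _ _).trans (min_le_right _ _)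
    · exact fun y hy => ((min_le_right _ _).trans (min_le_left _ _)).trans (h1' y (hppos y hy))
    · intro y hy
      have h := hpstrict y hy
      exact ⟨((min_le_right _ _).trans ((min_le_right _ _).trans (min_le_left _ _))).trans
          (h2' y (sub_pos.2 h.2)),
        ((min_le_right _ _).trans ((min_le_right _ _).trans (min_le_right _ _))).trans
          (h3' y (sub_pos.2 h.1))⟩
  let G : ℝ × (Fin N → ℝ) × (Y → ℝ) → ℝ := fun q =>
    dualLinear pL pU ε (DualVar.ofNet q) + ∫ x, dualMax c z L (DualVar.ofNet q) x ∂PX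
  -- A normalized multiplier with objective at most `G 0` has size at most `a + b * R`, where
  -- `R ≤ G 0 + K + τ * size`; the choice of `τ` makes the resulting recursive bound effective.
  let Q : ℝ := (1 + C / s) / s
  let a : ℝ := Fintype.card Y * O
  let b : ℝ := C / s + N * Q + Fintype.card Y * (Q + (1 + C) / s)
  have hQ : 0 ≤ Q := div_nonneg (by positivity) hs.le
  have hb : 0 ≤ b := by positivity
  let τ : ℝ := 1 / (2 * (b + 1))
  have hτ : 0 < τ := by positivity
  obtain ⟨K, hK⟩ := exists_neg_penalty_le_integral_dualMax hc hc0 hcC hL h₀ hτ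
  let R₀ : ℝ := |2 * (G 0 + K + τ * a)|
  have hR₀ : 0 ≤ R₀ := abs_nonneg _
  have hbounds : ∀ q : ℝ × (Fin N → ℝ) × (Y → ℝ), 0 ≤ q.1 → (∀ i, 0 ≤ q.2.1 i) →
      (∃ i, q.2.1 i = 0) → (pL k < pU k ∨ q.2.2 k = 0) →
      (∀ y, pU y = 0 → |q.2.2 y| ≤ O + q.1 * C + |q.2.2 k|) → G q ≤ G 0 →
      q.1 ≤ R₀ / s ∧ (∀ i, |q.2.1 i| ≤ R₀ * Q) ∧ ∀ y, |q.2.2 y| ≤ O + R₀ * (Q + (1 + C) / s) := by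
    rintro ⟨α, β, lam⟩ hα hβ hβ0 hanch hzero hG
    simp only at hα hβ hβ0 hanch hzero ⊢
    have hnet := DualVar.ofNet_lamU_sub_lamL (α, β, lam)
    simp only at hnet
    let d := DualVar.ofNet (α, β, lam)
    let R : ℝ := G (α, β, lam) + K + τ * d.size C
    have hlin : dualLinear pL pU ε d = α * ε + (1 / (N : ℝ)) * ∑ i, β i
        + ∑ y, (max (lam y) 0 * pU y - max (-lam y) 0 * pL y) := rfl
    have hmaxneg : ∀ y, max (lam y) 0 - max (-lam y) 0 = lam y := fun y =>
      max_zero_sub_max_neg_zero_eq_self _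
    have hlabels : ∑ y, (max (lam y) 0 * (pU y - p y) + max (-lam y) 0 * (p y - pL y)) =
        ∑ y, (max (lam y) 0 * pU y - max (-lam y) 0 * pL y) - ∑ y, p y * lam y := by
      rw [← Finset.sum_sub_distrib]
      refine Finset.sum_congr rfl fun y _ => ?_
      nth_rewrite 5 [← hmaxneg y]
      ring
    have hslater : α * s +
        ∑ y, (max (lam y) 0 * (pU y - p y) + max (-lam y) 0 * (p y - pL y)) ≤ R := by
      have h1 := hK d ρ₀ hρ₀.map_fst
      rw [integral_penalty hc hc0 hcC] at h1
      have h2 : ∑ i, d.β i * ρ₀.real ((fun p => p.2.2) ⁻¹' {i}) = (1 / (N : ℝ)) * ∑ i, β i := by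
        rw [Finset.mul_sum]
        exact Finset.sum_congr rfl fun i _ => by rw [hρ₀.index i, mul_comm]; rfl
      have h3 : ∑ y, (d.lamU y - d.lamL y) * ρ₀.real ((fun p => p.2.1) ⁻¹' {y}) =
          ∑ y, p y * lam y :=
        Finset.sum_congr rfl fun y _ => by rw [hnet y, mul_comm]
      have h4 : d.α * ∫ p, c (pairWithSample z p) ∂ρ₀ = α * cost₀ := rfl
      have h5 := mul_le_mul_of_nonneg_left hsε hα
      rw [h2, h3, h4] at h1
      rw [hlabels]
      simp only [R, G]
      rw [show DualVar.ofNet (α, β, lam) = d from rfl, hlin]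
      linarith
    have hpsum : 0 ≤ ∑ y, (max (lam y) 0 * (pU y - p y) + max (-lam y) 0 * (p y - pL y)) :=
      Finset.sum_nonneg fun y _ => add_nonneg
        (mul_nonneg (le_max_right _ _) (sub_nonneg.2 (hp y).2))
        (mul_nonneg (le_max_right _ _) (sub_nonneg.2 (hp y).1))
    have hdirac : ∀ i y, ((1 / (N : ℝ)) * ∑ i, β i - β i) + (∑ y, p y * lam y - lam y) - α * C
        ≤ R := by
      intro i y
      have hm : Measurable fun x : X => (x, (y, i)) := measurable_id.prodMk measurable_const
      have h1 := hK d (PX.map fun x => (x, (y, i))) (by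
        rw [Measure.map_map measurable_fst hm]; exact Measure.map_id)
      rw [integral_map hm.aemeasurable (measurable_penalty hc).aestronglyMeasurable] at h1
      have h2 : ∫ x, penalty c z d (x, (y, i)) ∂PX ≤ ∫ _, (α * C + β i + lam y) ∂PX := by
        refine integral_mono (Integrable.of_bound
          ((measurable_penalty hc).comp hm).aestronglyMeasurable (d.size C)
          (Filter.Eventually.of_forall fun x => abs_penalty_le hc0 hcC _))
          (integrable_const _) fun x => ?_
        simp only [penalty]
        rw [hnet y]
        exact add_le_add (add_le_add (mul_le_mul_of_nonneg_left (hcC _) hα) le_rfl) le_rfl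
      simp only [integral_const, probReal_univ, smul_eq_mul, one_mul] at h2
      have h3 := mul_nonneg hα hε
      rw [hlabels] at hpsum
      simp only [R, G]
      rw [show DualVar.ofNet (α, β, lam) = d from rfl, hlin]
      linarith
    obtain ⟨b1, b2, b3⟩ := multiplier_bounds hs hC hO hα hsN hp1 hp hsp hpzero hslack hk hanch
      hβ hβ0 hzero hslater hdirac
    have hsize : d.size C ≤ a + b * R := by
      have e1 : |d.α| * C ≤ R * (C / s) := by
        rw [show d.α = α from rfl, abs_of_nonneg hα]
        calc α * C ≤ R / s * C := mul_le_mul_of_nonneg_right b1 hC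
          _ = R * (C / s) := by ring
      have e2 : ∑ i, |d.β i| ≤ N * (R * Q) := by
        refine (Finset.sum_le_card_nsmul _ _ (R * Q) fun i _ => ?_).trans_eq (by simp)
        rw [show d.β i = β i from rfl, abs_of_nonneg (hβ i)]
        exact b2 i
      have e3 : ∑ y, |d.lamU y - d.lamL y| ≤
          Fintype.card Y * (O + R * (Q + (1 + C) / s)) := by
        refine (Finset.sum_le_card_nsmul _ _ (O + R * (Q + (1 + C) / s)) fun y _ => ?_).trans_eq
          (by rw [nsmul_eq_mul, Finset.card_univ])
        rw [hnet y]
        exact b3 y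
      calc d.size C ≤ R * (C / s) + N * (R * Q) +
            Fintype.card Y * (O + R * (Q + (1 + C) / s)) := add_le_add_three e1 e2 e3
        _ = a + b * R := by simp only [a, b]; ring
    have hRR₀ : R ≤ R₀ := by
      have h1 : R ≤ G 0 + K + τ * (a + b * R) :=
        add_le_add (add_le_add hG le_rfl) (mul_le_mul_of_nonneg_left hsize hτ.le)
      have hR : 0 ≤ R := (add_nonneg (mul_nonneg hα hs.le) hpsum).trans hslater
      have h2 : τ * b ≤ 1 / 2 := by
        simp only [τ]
        rw [div_mul_eq_mul_div, one_mul, div_le_div_iff₀ (by positivity) two_pos]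
        linarith
      have h3 := mul_le_mul_of_nonneg_right h2 hR
      have h4 : R ≤ 2 * (G 0 + K + τ * a) := by linarith
      exact h4.trans (le_abs_self _)
    refine ⟨b1.trans ?_, fun i => ?_, fun y => (b3 y).trans ?_⟩
    · exact div_le_div_of_nonneg_right hRR₀ hs.le
    · rw [abs_of_nonneg (hβ i)]
      exact (b2 i).trans (mul_le_mul_of_nonneg_right hRR₀ hQ)
    · have h1 : 0 ≤ Q + (1 + C) / s := by positivity
      linarith [mul_le_mul_of_nonneg_right hRR₀ h1]
  -- Minimize over the compact box given by these bounds.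
  let B : ℝ := O + R₀ * (Q + (1 + C) / s)
  have hB : 0 ≤ B := by positivity
  let box : Set (ℝ × (Fin N → ℝ) × (Y → ℝ)) := Set.Icc 0 (R₀ / s) ×ˢ
    ((Set.univ.pi fun _ => Set.Icc (-(R₀ * Q)) (R₀ * Q)) ×ˢ Set.univ.pi fun _ => Set.Icc (-B) B)
  have hbox : IsCompact box := isCompact_Icc.prod
    ((isCompact_univ_pi fun _ => isCompact_Icc).prod (isCompact_univ_pi fun _ => isCompact_Icc))
  have hRQ : 0 ≤ R₀ * Q := mul_nonneg hR₀ hQ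
  have h0box : (0 : ℝ × (Fin N → ℝ) × (Y → ℝ)) ∈ box :=
    ⟨⟨le_rfl, div_nonneg hR₀ hs.le⟩, fun i _ => ⟨neg_nonpos.2 hRQ, hRQ⟩,
      fun y _ => ⟨neg_nonpos.2 hB, hB⟩⟩
  obtain ⟨q, hq, hqmin⟩ := hbox.exists_isMinOn ⟨0, h0box⟩
    (continuous_dualObjective_ofNet hc hc0 hcC hL h₀ pL pU ε).continuousOn
  have hqmin' : ∀ q' ∈ box, G q ≤ G q' := fun q' hq' => hqmin hq'
  have hfeas : (DualVar.ofNet q).Feasible := DualVar.feasible_ofNet hq.1.1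
  have hint := fun d => integrable_dualMax hc hc0 hcC hL h₀ d
  refine ⟨DualVar.ofNet q, hfeas, le_antisymm (le_iInf₂ fun d hd => ?_) (iInf₂_le _ hfeas)⟩
  rw [dualObjective_of_integrable (hint _), dualObjective_of_integrable (hint _),
    EReal.coe_le_coe_iff]
  obtain ⟨q', h1, h2, h3, h4, h5, h6⟩ := exists_normalized_multipliers hc hc0 hcC hL h₀ hpL hpLU
    hp hp1 hk hanchor hO hLO ε hd
  refine le_trans ?_ h6
  change G q ≤ G q'
  by_cases hG : G q' ≤ G 0
  · obtain ⟨b1, b2, b3⟩ := hbounds q' h1 h2 h3 h4 h5 hG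
    exact hqmin' q' ⟨⟨h1, b1⟩, fun i _ => abs_le.1 (b2 i), fun y _ => abs_le.1 (b3 y)⟩
  · exact (hqmin' 0 h0box).trans (not_le.1 hG).le

end Attainment

end DRL

theorem theorem1
    {X Y : Type*}
    [TopologicalSpace X] [PolishSpace X] [CompactSpace X] [MeasurableSpace X] [BorelSpace X]
    [Fintype Y] [TopologicalSpace Y] [DiscreteTopology Y] [MeasurableSpace Y] [BorelSpace Y]
    (PX : Measure X) [IsProbabilityMeasure PX]
    {N : ℕ} (hN : 1 ≤ N) (z : Fin N → X × Y)
    (pL pU : Y → ℝ) (hpL : ∀ y, 0 ≤ pL y) (hpLU : ∀ y, pL y ≤ pU y) (hpU : ∀ y, pU y ≤ 1)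
    (c : (X × Y) × (X × Y) → ℝ) (hc_nonneg : ∀ p, 0 ≤ c p) (hc_usc : UpperSemicontinuous c)
    (hc_zero : ∀ w w', c (w, w') = 0 ↔ w = w')
    (ε : ℝ)
    {q : ℕ} (Θ : Set (EuclideanSpace ℝ (Fin q)))
    (h : EuclideanSpace ℝ (Fin q) → X → ProbabilityMeasure Y)
    (loss : ProbabilityMeasure Y → Y → ℝ)
    (hloss : ∀ θ ∈ Θ, UpperSemicontinuous (fun w : X × Y => loss (h θ w.1) w.2)) :
    ((DRL.decisionSet PX pL pU c ε z).Nonempty →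
      ∀ θ ∈ Θ,
        DRL.worstCase PX pL pU c ε z (fun w => loss (h θ w.1) w.2) =
          DRL.dualValue PX pL pU c ε z (fun w => loss (h θ w.1) w.2)) ∧
    ((DRL.relintDecisionSet PX pL pU c ε z).Nonempty →
      ∀ θ ∈ Θ,
        ((∀ y, 0 < pU y) ∨ BddBelow (Set.range fun w : X × Y => loss (h θ w.1) w.2)) →
        ∃ d : DRL.DualVar Y N, d.Feasible ∧
          DRL.dualObjective PX pL pU c ε z (fun w => loss (h θ w.1) w.2) d =
            DRL.dualValue PX pL pU c ε z (fun w => loss (h θ w.1) w.2)) := by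
  have hsing : MeasurableSingletonClass Y := ⟨fun y => (isClosed_discrete {y}).measurableSet⟩
  have hNz : NeZero N := ⟨by omega⟩
  have hYne : Nonempty Y := ⟨(z ⟨0, hN⟩).2⟩
  have hXne : Nonempty X := ⟨(z ⟨0, hN⟩).1⟩
  have hcm : Measurable c := hc_usc.measurable
  obtain ⟨C, hC⟩ := (hc_usc.upperSemicontinuousOn Set.univ).bddAbove_of_isCompact isCompact_univ
  have hcC : ∀ p, c p ≤ C := fun p => hC ⟨p, Set.mem_univ p, rfl⟩
  have hL : ∀ θ ∈ Θ, ∃ M, ∀ w : X × Y, loss (h θ w.1) w.2 ≤ M := fun θ hθ => by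
    obtain ⟨M, hM⟩ :=
      ((hloss θ hθ).upperSemicontinuousOn Set.univ).bddAbove_of_isCompact isCompact_univ
    exact ⟨M, fun w => hM ⟨w, Set.mem_univ w, rfl⟩⟩
  refine ⟨fun hne θ hθ => ?_, fun hne θ hθ hbdd => ?_⟩
  · obtain ⟨M, hM⟩ := hL θ hθ
    exact le_antisymm
      (DRL.worstCase_le_dualValue PX hcm hc_nonneg hcC (hloss θ hθ).measurable hM pL pU z ε)
      (DRL.dualValue_le_worstCase PX hcm hc_nonneg hcC (hloss θ hθ).measurable hM hpLU hne)
  · obtain ⟨M, hM⟩ := hL θ hθ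
    exact DRL.exists_dualObjective_eq_dualValue hcm hc_nonneg hcC (hloss θ hθ).measurable hM hpL
      hpLU hne hbdd
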